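/- **Data.** For the sampled units $i=1,2,\dots$ let $Y_i$ be a real outcome, $Z_i=(Z^c_i,Z^d_i)$ covariates with $Z_i^c\in\mathbb{R}^{p}$ (continuous) and $Z_i^d\in\mathbb{R}^r$ (discrete), $p,r\ge 0$, $D_i\in\{0,1\}$ the treatment, $\mathcal N_i$ and $\tilde{\mathcal N}_i$ two observed network proxies (finite random sets of members of the population), $S_i=\sum_{j\in\mathcal N_i}D_j$ and $\tilde S_i=\sum_{j\in\tilde{\mathcal N}_i}D_j$. Put $Q=p+1$, $W^c_i=(Y_i,Z^c_i)\in\mathbb{R}^Q$, $W^d_i=(D_i,Z^d_i,S_i,|\mathcal N_i|,\tilde S_i,|\tilde{\mathcal N}_i|)$, $W_i=(W_i^c,W_i^d)$, and let $\Omega_{W^c}$, $\Omega_{W^d}$ be the supports of $W^c_i$, $W^d_i$ (if the latter depends on $i$, the union over $i$). Each of the vectors $$(|\tilde{\mathcal N}_i|,|\mathcal N_i|,Y_i,Z_i),\quad (|\tilde{\mathcal N}_i|,|\mathcal N_i|,Z_i),\quad (S_i,|\mathcal N_i|,Z_i),\quad (|\mathcal N_i|,Z_i),\quad Z_i$$ is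 identically distributed across $i$ with a probability function (density with respect to the product of Lebesgue measure, for the continuous coordinates, and counting measure, for the discrete ones); $\gamma^0$ denotes the vector of these five probability functions. **Estimator.** Let $\kappa:\mathbb{R}\to\mathbb{R}$ be a kernel and $h=h_N>0$ a bandwidth. For any of the five vectors, written as $(V^c_i,V^d_i)$ with continuous part $V^c_i\in\mathbb{R}^m$ and discrete part $V^d_i$, let $$\hat f(v)=\frac1N\sum_{i=1}^N \frac1{h^m}\prod_{q=1}^m\kappa\Big(\frac{V^c_{i,q}-v^c_q}{h}\Big)\,1[V^d_i=v^d],$$ and let $\hat\gamma_N$ be the vector of the five estimators. Write $\|\hat\gamma_N-\gamma^0\|_\infty$ for the supremum of the absolute differences over the five components and over all $w\in\Omega_{W^c}\times\Omega_{W^d}$, each component being evaluated at the corresponding subvector of $w$. **Regularity.** (a) $\Omega_{W^c}$ is compact and convex, and $\Omega_{W^d}$ is finite. (b) On an open set containing $\Omega_{W^c}$, each element of $\gamma^0$ is bounded and twice continuously differentiable in $w^c$ with bounded derivatives of order one and two. (c) $\kappa\ge0$ is differentiable with bounded derivative, $\int\kappa(v)\,dv=1$, $\kappa(v)=\kappa(-v)$,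 and $\int v^2\kappa(v)\,dv$ and $\int\kappa(v)^2\,dv$ are finite and positive. (d) $h\to0$, $Nh^Q\to\infty$ and $\ln N/(Nh^Q)\to0$ as $N\to\infty$. (e) For each $N$ and $i\le N$ there is a non-random dependency neighbourhood $\Delta(i,N)\subset\{1,\dots,N\}$ with $i\in\Delta(i,N)$, such that $$\max_{i\le N}|\Delta(i,N)|\,[\ln N/(Nh^Q)]^{1/2}=O(1),\qquad \frac1N\sum_{i=1}^N|\Delta(i,N)|^2=O(1).$$ **Partition and mixing.** For each $N$, partition $\{1,\dots,N\}$ into blocks $\mathbb S_1,\dots,\mathbb S_{q_N}$ as follows. Start with $i_1=1$, $\mathbb S_1=\Delta(1,N)$. As long as $U_k=\bigcup_{l<k}\mathbb S_l\ne\{1,\dots,N\}$, choose $i_k\notin U_k$ for which $|U_k\cap\Delta(i_k,N)|$ is largest among all units outside $U_k$, and let $\mathbb S_k=\Delta(i_k,N)\setminus U_k$. Ties are broken arbitrarily; alternatively up to $M$ tied units may be chosen in the same step, where $M$ does not depend on $N$ or $k$, and then $\mathbb S_k$ is the union of their neighbourhoods minus $U_k$. Let $$\alpha_k=\sup\big\{|\Pr(A\cap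 B)-\Pr(A)\Pr(B)|:\ A\in\sigma(W_i,\ i\in\textstyle\bigcup_{l\le k-2}\mathbb S_l),\ B\in\sigma(W_i,\ i\in\mathbb S_k)\big\}.$$ With $L_N=[N/(\ln(N)h^{Q+2})]^{Q/2}$ and $\Psi_N=L_N\,(N/\ln N)^{1/2}\sum_{k=1}^{q_N}\alpha_k$, assume $\sum_{N\ge2}\Psi_N<\infty$. **Conclusion.** Then $$\|\hat\gamma_N-\gamma^0\|_\infty=O_p\big([\ln N/(Nh^Q)]^{1/2}+h^2\big).$$ -/

import Mathlib

open MeasureTheory Filter Asymptotics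

/-! ### Kernel estimators of mixed continuous / discrete densities -/

/-- The kernel estimator `f̂(wc, wd) = (1/N) ∑_{i<N} K(xcᵢ, wc) 1[xdᵢ = wd]`, where
`K(xc, wc) = h^{-m} ∏_q κ((xc_q - wc_q)/h)`, computed from the first `N` observations
`(xcᵢ, xdᵢ)`, whose continuous part has dimension `m`. -/
noncomputable def kernelEstimator (κ : ℝ → ℝ) (h : ℝ) (N : ℕ) {m : ℕ} {E : Type*}
    (xc : ℕ → Fin m → ℝ) (xd : ℕ → E) (wc : Fin m → ℝ) (wd : E) : ℝ :=
  open Classical in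
  (1 / (N : ℝ)) * ∑ i ∈ Finset.range N,
    (1 / h ^ m * ∏ q, κ ((xc i q - wc q) / h)) * (if xd i = wd then 1 else 0)

/-- `f` is (a version of) the common probability function of all the mixed vectors
`(Xc i, Xd i)`: for each `i` and each value `wd` of the discrete part, `f (·, wd)` is the
Lebesgue density of the (sub-probability) law of `Xc i` on the event `Xd i = wd`. -/
structure IsMixedDensity {Ω : Type*} [MeasurableSpace Ω] (μ : Measure Ω) {m : ℕ} {E : Type*}
    (Xc : ℕ → Ω → Fin m → ℝ) (Xd : ℕ → Ω → E) (f : (Fin m → ℝ) → E → ℝ) : Prop where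
  nonneg : ∀ wc wd, 0 ≤ f wc wd
  measurable : ∀ wd, Measurable fun wc => f wc wd
  density : ∀ i wd, (μ.restrict {ω | Xd i ω = wd}).map (Xc i)
    = (volume : Measure (Fin m → ℝ)).withDensity fun wc => ENNReal.ofReal (f wc wd)

/-- The support of the (common) law of the random elements `X i`. -/
def lawSupport {Ω E : Type*} [MeasurableSpace Ω] [MeasurableSpace E] [TopologicalSpace E]
    (μ : Measure Ω) (X : ℕ → Ω → E) : Set E :=
  ⋃ i, (μ.map (X i)).support

/-! ### The observed data -/

/-- Values `(y, zᶜ)` of the continuous observables `Wᶜ = (Y, Zᶜ)`; coordinate `0` is `y`. -/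
abbrev ContObs (p : ℕ) : Type := Fin (p + 1) → ℝ

/-- Values `(d, zᵈ, s, n, s̃, ñ)` of the discrete observables
`Wᵈ = (D, Zᵈ, S, |𝒩|, S̃, |𝒩̃|)`. -/
abbrev DiscObs (r : ℕ) : Type := Bool × (Fin r → ℝ) × ℕ × ℕ × ℕ × ℕ

/-- Sampled units `0, 1, 2, …` of a population `P`: outcomes `Y`, continuous and discrete
covariates `Zc`, `Zd`, the treatment status of every member of the population, and the two
network proxies `nbr i` and `nbr' i` (finite random sets of members of the population). -/
structure NetworkSample (Ω P : Type*) (p r : ℕ) where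
  unit : ℕ → P
  treat : P → Ω → Bool
  Y : ℕ → Ω → ℝ
  Zc : ℕ → Ω → Fin p → ℝ
  Zd : ℕ → Ω → Fin r → ℝ
  nbr : ℕ → Ω → Finset P
  nbr' : ℕ → Ω → Finset P

namespace NetworkSample

variable {Ω P : Type*} {p r : ℕ} (X : NetworkSample Ω P p r)

/-- Own treatment `D_i`. -/
def D (i : ℕ) (ω : Ω) : Bool := X.treat (X.unit i) ω

/-- Observed degree `|𝒩_i|`. -/
def deg (i : ℕ) (ω : Ω) : ℕ := (X.nbr i ω).card

/-- Observed degree `|𝒩̃_i|` of the second proxy. -/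
def deg' (i : ℕ) (ω : Ω) : ℕ := (X.nbr' i ω).card

/-- Number of treated observed neighbours, `S_i = ∑_{j ∈ 𝒩_i} D_j`. -/
def S (i : ℕ) (ω : Ω) : ℕ := ∑ j ∈ X.nbr i ω, (X.treat j ω).toNat

/-- Number of treated observed neighbours for the second proxy. -/
def S' (i : ℕ) (ω : Ω) : ℕ := ∑ j ∈ X.nbr' i ω, (X.treat j ω).toNat

/-- Continuous observables `Wᶜ_i = (Y_i, Zᶜ_i)`. -/
def Wc (i : ℕ) (ω : Ω) : ContObs p := Fin.cons (X.Y i ω) (X.Zc i ω)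

/-- Discrete observables `Wᵈ_i = (D_i, Zᵈ_i, S_i, |𝒩_i|, S̃_i, |𝒩̃_i|)`. -/
def Wd (i : ℕ) (ω : Ω) : DiscObs r :=
  (X.D i ω, X.Zd i ω, X.S i ω, X.deg i ω, X.S' i ω, X.deg' i ω)

/-- All observables `W_i = (Wᶜ_i, Wᵈ_i)`. -/
def W (i : ℕ) (ω : Ω) : ContObs p × DiscObs r := (X.Wc i ω, X.Wd i ω)

/-- The discrete part of `(|𝒩̃_i|, |𝒩_i|, Y_i, Z_i)` and of `(|𝒩̃_i|, |𝒩_i|, Z_i)`. -/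
def degDegZd (i : ℕ) (ω : Ω) : ℕ × ℕ × (Fin r → ℝ) := (X.deg' i ω, X.deg i ω, X.Zd i ω)

/-- The discrete part of `(S_i, |𝒩_i|, Z_i)`. -/
def sDegZd (i : ℕ) (ω : Ω) : ℕ × ℕ × (Fin r → ℝ) := (X.S i ω, X.deg i ω, X.Zd i ω)

/-- The discrete part of `(|𝒩_i|, Z_i)`. -/
def degZd (i : ℕ) (ω : Ω) : ℕ × (Fin r → ℝ) := (X.deg i ω, X.Zd i ω)

end NetworkSample

/-! ### The nuisance parameter and its estimator -/

/-- The estimator `γ̂_N = (f̂_{|𝒩̃|,|𝒩|,Y,Z}, f̂_{|𝒩̃|,|𝒩|,Z}, f̂_{S,|𝒩|,Z}, f̂_{|𝒩|,Z}, f̂_Z)`,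
as a vector of functions of the point `w = (wᶜ, wᵈ)`, `wᶜ = (y, zᶜ)`,
`wᵈ = (d, zᵈ, s, n, s̃, ñ)`. -/
noncomputable def gammaHat {Ω P : Type*} {p r : ℕ} (X : NetworkSample Ω P p r) (κ : ℝ → ℝ)
    (h : ℝ) (N : ℕ) (ω : Ω) : ContObs p × DiscObs r → Fin 5 → ℝ
  | (wc, (_, zd, s, n, _, n')) =>
    ![kernelEstimator κ h N (fun i => X.Wc i ω) (fun i => X.degDegZd i ω) wc (n', n, zd),
      kernelEstimator κ h N (fun i => X.Zc i ω) (fun i => X.degDegZd i ω)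
        (Fin.tail wc) (n', n, zd),
      kernelEstimator κ h N (fun i => X.Zc i ω) (fun i => X.sDegZd i ω)
        (Fin.tail wc) (s, n, zd),
      kernelEstimator κ h N (fun i => X.Zc i ω) (fun i => X.degZd i ω)
        (Fin.tail wc) (n, zd),
      kernelEstimator κ h N (fun i => X.Zc i ω) (fun i => X.Zd i ω)
        (Fin.tail wc) zd]

/-- Five functions of the arguments of the five probability functions in `γ⁰`. -/
structure NuisanceParam (p r : ℕ) where
  fNNYZ : ContObs p → ℕ × ℕ × (Fin r → ℝ) → ℝ
  fNNZ : (Fin p → ℝ) → ℕ × ℕ × (Fin r → ℝ) → ℝ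
  fSNZ : (Fin p → ℝ) → ℕ × ℕ × (Fin r → ℝ) → ℝ
  fNZ : (Fin p → ℝ) → ℕ × (Fin r → ℝ) → ℝ
  fZ : (Fin p → ℝ) → (Fin r → ℝ) → ℝ

/-- A nuisance parameter as a vector of five functions of the point `w = (wᶜ, wᵈ)`. -/
def NuisanceParam.eval {p r : ℕ} (γ : NuisanceParam p r) :
    ContObs p × DiscObs r → Fin 5 → ℝ
  | (wc, (_, zd, s, n, _, n')) =>
    ![γ.fNNYZ wc (n', n, zd), γ.fNNZ (Fin.tail wc) (n', n, zd),
      γ.fSNZ (Fin.tail wc) (s, n, zd), γ.fNZ (Fin.tail wc) (n, zd), γ.fZ (Fin.tail wc) zd]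

/-- `γ` is the true value `γ⁰`: its entries are the probability functions (the same for all
units `i`) of the five vectors of observables. -/
structure IsTrueNuisance {Ω P : Type*} [MeasurableSpace Ω] (μ : Measure Ω) {p r : ℕ}
    (X : NetworkSample Ω P p r) (γ : NuisanceParam p r) : Prop where
  fNNYZ : IsMixedDensity μ X.Wc X.degDegZd γ.fNNYZ
  fNNZ : IsMixedDensity μ X.Zc X.degDegZd γ.fNNZ
  fSNZ : IsMixedDensity μ X.Zc X.sDegZd γ.fSNZ
  fNZ : IsMixedDensity μ X.Zc X.degZd γ.fNZ
  fZ : IsMixedDensity μ X.Zc X.Zd γ.fZ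

/-! ### Regularity of the data distribution, the kernel and the bandwidth -/

/-- The continuous observables have a compact convex support, the discrete ones a finite
support. -/
structure SupportRegular {Ω P : Type*} [MeasurableSpace Ω] (μ : Measure Ω) {p r : ℕ}
    (X : NetworkSample Ω P p r) : Prop where
  isCompact : IsCompact (lawSupport μ X.Wc)
  convex : Convex ℝ (lawSupport μ X.Wc)
  finite : (lawSupport μ X.Wd).Finite

/-- On an open set `U ⊇ Ω_{Wᶜ}`, each entry of `γ` is twice continuously differentiable in `wᶜ`,
and bounded together with its derivatives of order one and two. -/
def NuisanceRegular {Ω P : Type*} [MeasurableSpace Ω] (μ : Measure Ω) {p r : ℕ}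
    (X : NetworkSample Ω P p r) (γ : NuisanceParam p r) : Prop :=
  ∃ U : Set (ContObs p), IsOpen U ∧ lawSupport μ X.Wc ⊆ U ∧ ∃ C : ℝ,
    ∀ wd ∈ lawSupport μ X.Wd, ∀ k : Fin 5,
      ContDiffOn ℝ 2 (fun wc => γ.eval (wc, wd) k) U ∧
      ∀ wc ∈ U, ∀ n : ℕ, n ≤ 2 → ‖iteratedFDeriv ℝ n (fun wc => γ.eval (wc, wd) k) wc‖ ≤ C

/-- The conditions on the univariate kernel function. -/
structure KernelRegular (κ : ℝ → ℝ) : Prop where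
  nonneg : ∀ v, 0 ≤ κ v
  differentiable : Differentiable ℝ κ
  deriv_bounded : ∃ C : ℝ, ∀ v, |deriv κ v| ≤ C
  integrable : Integrable κ
  integral_eq_one : ∫ v, κ v = 1
  symm : ∀ v, κ v = κ (-v)
  second_moment : Integrable (fun v => v ^ 2 * κ v) ∧ 0 < ∫ v, v ^ 2 * κ v
  sq_integral : Integrable (fun v => κ v ^ 2) ∧ 0 < ∫ v, κ v ^ 2

/-- The conditions on the bandwidth, `Q` being the number of continuous variables. -/
structure BandwidthRegular (Q : ℕ) (h : ℕ → ℝ) : Prop where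
  pos : ∀ N, 0 < h N
  tendsto_zero : Tendsto h atTop (nhds 0)
  tendsto_atTop : Tendsto (fun N : ℕ => (N : ℝ) * h N ^ Q) atTop atTop
  log_tendsto_zero :
    Tendsto (fun N : ℕ => Real.log N / ((N : ℝ) * h N ^ Q)) atTop (nhds 0)

/-! ### Dependency neighbourhoods and the induced partition -/

/-- `Δ N i` (for `i < N`) is a set of units of the sample `{0, …, N-1}` containing `i`; the
cardinalities satisfy `r̄_N [ln N / (N h^Q)]^{1/2} = O(1)` for `r̄_N = max_i |Δ(i,N)|`, and
`(1/N) ∑_i |Δ(i,N)|² = O(1)`. -/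
structure NeighbourhoodsRegular (Q : ℕ) (h : ℕ → ℝ) (Δ : ℕ → ℕ → Finset ℕ) : Prop where
  self_mem : ∀ N, ∀ i < N, i ∈ Δ N i
  subset : ∀ N, ∀ i < N, Δ N i ⊆ Finset.range N
  max_card : (fun N : ℕ => (((Finset.range N).sup fun i => (Δ N i).card : ℕ) : ℝ) *
      (Real.log N / ((N : ℝ) * h N ^ Q)) ^ (1 / 2 : ℝ)) =O[atTop] fun _ => (1 : ℝ)
  sum_card_sq : (fun N : ℕ => (1 / (N : ℝ)) *
      ∑ i ∈ Finset.range N, ((Δ N i).card : ℝ) ^ 2) =O[atTop] fun _ => (1 : ℝ)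

/-- The union of the neighbourhoods of the units chosen before step `k`, where `I l` is the
set of the units chosen at step `l`. -/
def coveredBefore (Δ : ℕ → Finset ℕ) (I : ℕ → Finset ℕ) (k : ℕ) : Finset ℕ :=
  (Finset.range k).biUnion fun l => (I l).biUnion Δ

/-- The `k`-th block: the neighbourhood of the units chosen at step `k` without the earlier
blocks. -/
def blockAt (Δ : ℕ → Finset ℕ) (I : ℕ → Finset ℕ) (k : ℕ) : Finset ℕ :=
  (I k).biUnion Δ \ coveredBefore Δ I k

/-- The construction of the partition of `{0, …, N-1}` into `q` blocks. It starts from the first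
unit. At each later step, the chosen unit lies outside the neighbourhoods of the units chosen
before, and its own neighbourhood has, among all such units, the largest overlap with them;
several units that attain this maximum simultaneously may be chosen together (at most `M`). The
construction ends when all the units are covered. -/
structure IsGreedyPartition (N : ℕ) (Δ : ℕ → Finset ℕ) (M q : ℕ) (I : ℕ → Finset ℕ) : Prop where
  pos : 0 < q
  first : I 0 = {0}
  nonempty : ∀ k < q, (I k).Nonempty
  card_le : ∀ k < q, (I k).card ≤ M
  maximal : ∀ k, 0 < k → k < q → ∀ i ∈ I k,
    i ∈ Finset.range N \ coveredBefore Δ I k ∧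
    ∀ j ∈ Finset.range N \ coveredBefore Δ I k,
      (coveredBefore Δ I k ∩ Δ j).card ≤ (coveredBefore Δ I k ∩ Δ i).card
  covers : coveredBefore Δ I q = Finset.range N

/-! ### The dependence coefficients -/

/-- The σ-algebra generated by the `W i`, `i ∈ s`. -/
abbrev sigmaGen {Ω E : Type*} [mE : MeasurableSpace E] (W : ℕ → Ω → E) (s : Finset ℕ) :
    MeasurableSpace Ω :=
  ⨆ i ∈ s, mE.comap (W i)

/-- The strong mixing coefficient `sup_{A ∈ 𝒜, B ∈ ℬ} |Pr(A ∩ B) - Pr(A) Pr(B)|`. -/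
noncomputable def strongMixingCoeff {Ω : Type*} [MeasurableSpace Ω] (μ : Measure Ω)
    (𝒜 ℬ : MeasurableSpace Ω) : ℝ :=
  ⨆ AB : {A : Set Ω // MeasurableSet[𝒜] A} × {B : Set Ω // MeasurableSet[ℬ] B},
    |μ.real (AB.1.1 ∩ AB.2.1) - μ.real AB.1.1 * μ.real AB.2.1|

/-- The dependence coefficient between block `k` and the union of all the blocks up to the last
but one before it (blocks are numbered from `0`; the union is empty for `k = 0, 1`). -/
noncomputable def blockDependence {Ω E : Type*} [MeasurableSpace Ω] [MeasurableSpace E]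
    (μ : Measure Ω) (W : ℕ → Ω → E) (Δ : ℕ → Finset ℕ) (I : ℕ → Finset ℕ) (k : ℕ) : ℝ :=
  strongMixingCoeff μ
    (sigmaGen W ((Finset.range (k - 1)).biUnion (blockAt Δ I)))
    (sigmaGen W (blockAt Δ I k))

/-- `Ψ_N = L_N (N / ln N)^{1/2} ∑_k α_k` with `L_N = [N / (ln N · h^{Q+2})]^{Q/2}`, where the sum
of the dependence coefficients is `αsum`. -/
noncomputable def mixingPsi (Q : ℕ) (h : ℝ) (N : ℕ) (αsum : ℝ) : ℝ :=
  ((N : ℝ) / (Real.log N * h ^ (Q + 2))) ^ ((Q : ℝ) / 2) *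
    ((N : ℝ) / Real.log N) ^ (1 / 2 : ℝ) * αsum

/-! ### Rates in probability -/

/-- `Z_N = O_p(a_N)` for nonnegative random quantities `Z_N`. -/
def IsBigOInProb {Ω : Type*} [MeasurableSpace Ω] (μ : Measure Ω) (Z : ℕ → Ω → ENNReal)
    (a : ℕ → ℝ) : Prop :=
  ∀ ε : ℝ, 0 < ε → ∃ M : ℝ, 0 < M ∧ ∀ᶠ N in atTop,
    μ {ω | ENNReal.ofReal (M * a N) < Z N ω} ≤ ENNReal.ofReal ε

/-- The sup-norm `‖g‖_∞ = sup_{w ∈ A} max_k |g_k(w)|` of a vector of functions on the set `A`. -/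
noncomputable def supNormOn {E : Type*} (A : Set E) (g : E → Fin 5 → ℝ) : ENNReal :=
  ⨆ w ∈ A, ‖g w‖ₑ

/-!
The estimation error splits into a bias of order `h²` and a centred part of order
`ε = (ln N / (N h^Q))^{1/2}`, with `Q = p + 1`. Each component of the estimator and each of the
finitely many values of the discrete observables is treated separately
(`exists_tendsto_measure_cell`).

*Bias.* A density that is `C²` on a neighbourhood of the compact support vanishes on the part of the
neighbourhood outside the support, so its extension by zero is `C²` everywhere and there is no
boundary effect (`exists_extension_bounded_second_difference`). The kernel being symmetric, the bias
is an integral of second differences (`abs_integral_prodKernel_mul_sub_le`).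

*Centred part.* At a fixed point the centred sum is grouped into the blocks of the partition. Blocks
of the same parity are nearly independent. Each block sum is discretized at scale `ε`, which leaves
`n = O(N / ln N)` values. For two discrete variables, one of them with `n` values, the distance in
total variation between the joint law and the product of the marginals is `O(√n α)`, where `α` is
the strong mixing coefficient; the factor `√n` instead of `n` is due to Khintchine's inequality
(`sum_sum_abs_le_of_rectangle_sums`). The blocks can therefore be replaced by independent ones
(`integral_sum_le_prod_exp_moment`) at a total cost of `O((N / ln N)^{1/2} ∑ₖ αₖ)`, after which
Bernstein's bound applies (`measureReal_abs_block_sum_ge_le`). Its variance term is controlled by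
`∑ₖ |𝕊ₖ|² ≤ M ∑ᵢ |Δ(i,N)|²`, which holds because a chosen unit belongs to its own neighbourhood and
is not covered by the earlier blocks, so that every unit is chosen at most once
(`IsGreedyPartition.sum_card_blockAt_sq_le`).

*Uniformity.* The kernel estimator is Lipschitz with constant `O(h^{-Q-1})`, so a net of width
`h^{Q+1} ε` suffices. It has `O(L_N)` points (`one_div_netWidth_pow`), and the union bound over it
gives `O(1 / N + Ψ_N)`, which tends to zero (`exists_tendsto_measure_deviation`).
-/

/-! ### Total variation from strong mixing for discrete variables -/

/-- The Rademacher sum of `a` over `s` in which the indices in `t` have sign `+` and the others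
sign `-`. -/
def signedSum {ι : Type*} [DecidableEq ι] (a : ι → ℝ) (s t : Finset ι) : ℝ :=
  ∑ j ∈ s, if j ∈ t then a j else -a j

lemma sum_powerset_insert_signedSum {ι : Type*} [DecidableEq ι] (a : ι → ℝ) {s : Finset ι} {x : ι}
    (hx : x ∉ s) (F : ℝ → ℝ) :
    ∑ t ∈ (insert x s).powerset, F (signedSum a (insert x s) t)
      = ∑ t ∈ s.powerset, (F (signedSum a s t - a x) + F (signedSum a s t + a x)) := by
  rw [Finset.sum_powerset_insert hx, ← Finset.sum_add_distrib]
  refine Finset.sum_congr rfl fun t ht => ?_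
  have hxt : x ∉ t := fun h => hx (Finset.mem_powerset.1 ht h)
  congr 2
  · simp only [signedSum]
    rw [Finset.sum_insert hx, if_neg hxt]; ring
  · simp only [signedSum]
    rw [Finset.sum_insert hx, if_pos (Finset.mem_insert_self _ _), add_comm]
    congr 1
    refine Finset.sum_congr rfl fun j hj => ?_
    have : j ≠ x := fun h => hx (h ▸ hj)
    simp [this]

lemma sum_powerset_signedSum_sq {ι : Type*} [DecidableEq ι] (a : ι → ℝ) (s : Finset ι) :
    ∑ t ∈ s.powerset, signedSum a s t ^ 2 = 2 ^ s.card * ∑ j ∈ s, a j ^ 2 := by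
  induction s using Finset.induction_on with
  | empty => simp [signedSum]
  | insert x s hx ih =>
    rw [sum_powerset_insert_signedSum a hx (fun y => y ^ 2), Finset.card_insert_of_notMem hx,
      Finset.sum_insert hx]
    have : ∀ t ∈ s.powerset, (signedSum a s t - a x) ^ 2 + (signedSum a s t + a x) ^ 2
        = 2 * signedSum a s t ^ 2 + 2 * a x ^ 2 := fun t _ => by ring
    rw [Finset.sum_congr rfl this, Finset.sum_add_distrib, ← Finset.mul_sum, ih]
    simp only [Finset.sum_const, Finset.card_powerset, nsmul_eq_mul]
    push_cast
    ring

lemma sum_powerset_signedSum_pow_four_le {ι : Type*} [DecidableEq ι] (a : ι → ℝ) (s : Finset ι) :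
    ∑ t ∈ s.powerset, signedSum a s t ^ 4 ≤ 2 ^ s.card * (3 * (∑ j ∈ s, a j ^ 2) ^ 2) := by
  induction s using Finset.induction_on with
  | empty => simp [signedSum]
  | insert x s hx ih =>
    rw [sum_powerset_insert_signedSum a hx (fun y => y ^ 4), Finset.card_insert_of_notMem hx,
      Finset.sum_insert hx]
    have : ∀ t ∈ s.powerset, (signedSum a s t - a x) ^ 4 + (signedSum a s t + a x) ^ 4
        = 2 * signedSum a s t ^ 4 + 12 * a x ^ 2 * signedSum a s t ^ 2 + 2 * a x ^ 4 :=
      fun t _ => by ring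
    rw [Finset.sum_congr rfl this, Finset.sum_add_distrib, Finset.sum_add_distrib,
      ← Finset.mul_sum, ← Finset.mul_sum, sum_powerset_signedSum_sq]
    simp only [Finset.sum_const, Finset.card_powerset, nsmul_eq_mul]
    push_cast
    have h4 : 0 ≤ (2 : ℝ) ^ s.card * a x ^ 4 := by positivity
    rw [pow_succ (2 : ℝ)]
    nlinarith

/-- **Khintchine's inequality** (lower bound for the first moment), combined with Cauchy–Schwarz.
The first moment is bounded below through `t ≥ t² - t⁴ / 6` and the second and fourth moments. -/
lemma sum_abs_le_avg_abs_signedSum {ι : Type*} [DecidableEq ι] (a : ι → ℝ) (s : Finset ι) :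
    2 ^ s.card * ∑ j ∈ s, |a j|
      ≤ 2 * √s.card * ∑ t ∈ s.powerset, |signedSum a s t| := by
  set V := ∑ j ∈ s, a j ^ 2 with hV
  have hV0 : 0 ≤ V := Finset.sum_nonneg fun _ _ => sq_nonneg _
  have hCS : ∑ j ∈ s, |a j| ≤ √s.card * √V := by
    rw [← Real.sqrt_mul (Nat.cast_nonneg _)]
    apply Real.le_sqrt_of_sq_le
    have := sq_sum_le_card_mul_sum_sq (s := s) (f := fun j => |a j|)
    simpa [sq_abs] using this
  rcases hV0.eq_or_lt with h0 | hpos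
  · rw [← h0] at hCS
    have h1 : ∑ j ∈ s, |a j| ≤ 0 := by simpa using hCS
    have h2 : (0 : ℝ) ≤ 2 * √s.card * ∑ t ∈ s.powerset, |signedSum a s t| :=
      mul_nonneg (by positivity) (Finset.sum_nonneg fun _ _ => abs_nonneg _)
    have h3 : (2 : ℝ) ^ s.card * ∑ j ∈ s, |a j| ≤ 0 :=
      mul_nonpos_of_nonneg_of_nonpos (by positivity) h1
    linarith
  set σ := √V with hσ
  have hσpos : 0 < σ := Real.sqrt_pos.2 hpos
  have hσ2 : σ ^ 2 = V := Real.sq_sqrt hV0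
  have key : ∀ y : ℝ, σ ^ 2 * y ^ 2 - y ^ 4 / 6 ≤ σ ^ 3 * |y| := by
    intro y
    have hy : y ^ 2 = |y| ^ 2 := (sq_abs y).symm
    have hy4 : y ^ 4 = |y| ^ 4 := by
      rw [show y ^ 4 = (y ^ 2) ^ 2 by ring, hy]; ring
    rw [hy, hy4]
    have hz := abs_nonneg y
    set z := |y|
    -- the cubic is minimal at `z = √2 σ`, where it is still positive
    have hcub : 0 ≤ σ ^ 3 - σ ^ 2 * z + z ^ 3 / 6 := by
      nlinarith [mul_nonneg (add_nonneg hz hσpos.le) (sq_nonneg (z - 1.4 * σ)),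
        mul_nonneg hz (sq_nonneg (z - 1.4 * σ)), mul_nonneg hσpos.le (sq_nonneg (z - 1.4 * σ)),
        pow_pos hσpos 3, mul_pos hσpos hσpos]
    nlinarith [mul_nonneg hz hcub]
  have hsum : ∑ t ∈ s.powerset, (σ ^ 2 * signedSum a s t ^ 2 - signedSum a s t ^ 4 / 6)
      ≤ ∑ t ∈ s.powerset, σ ^ 3 * |signedSum a s t| := Finset.sum_le_sum fun t _ => key _
  rw [Finset.sum_sub_distrib, ← Finset.mul_sum, ← Finset.mul_sum, ← Finset.sum_div,
    sum_powerset_signedSum_sq, ← hV, ← hσ2] at hsum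
  have h4 := sum_powerset_signedSum_pow_four_le a s
  rw [← hV, ← hσ2] at h4
  have h5 : σ ^ 3 * (2 ^ s.card * σ) ≤ σ ^ 3 * (2 * ∑ t ∈ s.powerset, |signedSum a s t|) := by
    nlinarith
  have h6 := le_of_mul_le_mul_left h5 (by positivity)
  calc (2 : ℝ) ^ s.card * ∑ j ∈ s, |a j| ≤ 2 ^ s.card * (√s.card * σ) := by gcongr
    _ = √s.card * (2 ^ s.card * σ) := by ring
    _ ≤ √s.card * (2 * ∑ t ∈ s.powerset, |signedSum a s t|) := by gcongr
    _ = _ := by ring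

/-- If all rectangular sums of a matrix with `n` columns are bounded by `α`, then its `ℓ¹`-norm is
at most `8 √n α`. Khintchine's inequality in each row is what gives `√n` rather than `n`. -/
lemma sum_sum_abs_le_of_rectangle_sums {ι ι' : Type*} [DecidableEq ι]
    (m : ι' → ι → ℝ) (r : Finset ι') (s : Finset ι) {α : ℝ}
    (hm : ∀ A ⊆ r, ∀ B ⊆ s, |∑ i ∈ A, ∑ j ∈ B, m i j| ≤ α) :
    ∑ i ∈ r, ∑ j ∈ s, |m i j| ≤ 8 * √s.card * α := by
  classical
  have hrow : ∀ t ∈ s.powerset, ∑ i ∈ r, |signedSum (m i) s t| ≤ 4 * α := by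
    intro t ht
    have ht' := Finset.mem_powerset.1 ht
    have hS : ∀ i, signedSum (m i) s t = ∑ j ∈ t, m i j - ∑ j ∈ s \ t, m i j := by
      intro i
      rw [signedSum, ← Finset.sum_sdiff ht', add_comm, sub_eq_add_neg, ← Finset.sum_neg_distrib]
      congr 1
      · exact Finset.sum_congr rfl fun j hj => if_pos hj
      · exact Finset.sum_congr rfl fun j hj => if_neg (Finset.mem_sdiff.1 hj).2
    rw [← Finset.sum_filter_add_sum_filter_not r (fun i => 0 ≤ signedSum (m i) s t)]
    have h1 : ∑ i ∈ r with 0 ≤ signedSum (m i) s t, |signedSum (m i) s t|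
        = ∑ i ∈ r with 0 ≤ signedSum (m i) s t, ∑ j ∈ t, m i j
          - ∑ i ∈ r with 0 ≤ signedSum (m i) s t, ∑ j ∈ s \ t, m i j := by
      rw [← Finset.sum_sub_distrib]
      refine Finset.sum_congr rfl fun i hi => ?_
      rw [abs_of_nonneg (Finset.mem_filter.1 hi).2, hS]
    have h2 : ∑ i ∈ r with ¬ 0 ≤ signedSum (m i) s t, |signedSum (m i) s t|
        = ∑ i ∈ r with ¬ 0 ≤ signedSum (m i) s t, ∑ j ∈ s \ t, m i j
          - ∑ i ∈ r with ¬ 0 ≤ signedSum (m i) s t, ∑ j ∈ t, m i j := by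
      rw [← Finset.sum_sub_distrib]
      refine Finset.sum_congr rfl fun i hi => ?_
      rw [abs_of_neg (not_le.1 (Finset.mem_filter.1 hi).2), hS]; ring
    rw [h1, h2]
    have e1 := abs_le.1 (hm _ (Finset.filter_subset (fun i => 0 ≤ signedSum (m i) s t) r) t ht')
    have e2 := abs_le.1 (hm _ (Finset.filter_subset (fun i => 0 ≤ signedSum (m i) s t) r) (s \ t)
      Finset.sdiff_subset)
    have e3 := abs_le.1 (hm _ (Finset.filter_subset (fun i => ¬ 0 ≤ signedSum (m i) s t) r) t ht')
    have e4 := abs_le.1 (hm _ (Finset.filter_subset (fun i => ¬ 0 ≤ signedSum (m i) s t) r) (s \ t)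
      Finset.sdiff_subset)
    linarith [e1.1, e1.2, e2.1, e2.2, e3.1, e3.2, e4.1, e4.2]
  have h2pos : (0 : ℝ) < 2 ^ s.card := by positivity
  refine le_of_mul_le_mul_left ?_ h2pos
  calc (2 : ℝ) ^ s.card * ∑ i ∈ r, ∑ j ∈ s, |m i j|
      = ∑ i ∈ r, 2 ^ s.card * ∑ j ∈ s, |m i j| := Finset.mul_sum _ _ _
    _ ≤ ∑ i ∈ r, 2 * √s.card * ∑ t ∈ s.powerset, |signedSum (m i) s t| :=
        Finset.sum_le_sum fun i _ => sum_abs_le_avg_abs_signedSum _ _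
    _ = 2 * √s.card * ∑ t ∈ s.powerset, ∑ i ∈ r, |signedSum (m i) s t| := by
        rw [← Finset.mul_sum, Finset.sum_comm]
    _ ≤ 2 * √s.card * ∑ t ∈ s.powerset, 4 * α := by
        gcongr with t ht
        exact hrow t ht
    _ = _ := by
        simp only [Finset.sum_const, Finset.card_powerset, nsmul_eq_mul]
        push_cast; ring

/-! ### Sums of weakly dependent discrete variables -/

lemma integral_comp_eq_sum_measureReal {Ω β : Type*} [MeasurableSpace Ω] {μ : Measure Ω}
    [IsProbabilityMeasure μ] [MeasurableSpace β] [MeasurableSingletonClass β] {Y : Ω → β}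
    (hY : Measurable Y) {s : Finset β} (hs : ∀ ω, Y ω ∈ s) (g : β → ℝ) :
    ∫ ω, g (Y ω) ∂μ = ∑ b ∈ s, μ.real (Y ⁻¹' {b}) * g b := by
  classical
  have h : ∀ ω, g (Y ω) = ∑ b ∈ s, (Y ⁻¹' {b}).indicator (fun _ => g b) ω := by
    intro ω
    rw [Finset.sum_eq_single_of_mem (Y ω) (hs ω)]
    · simp
    · intro b _ hb
      exact Set.indicator_of_notMem (fun h => hb (by simpa using h.symm)) _
  simp_rw [h]
  rw [integral_finsetSum _ fun b _ =>
    (integrable_const (g b)).indicator (hY (measurableSet_singleton b))]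
  refine Finset.sum_congr rfl fun b _ => ?_
  rw [integral_indicator_const _ (hY (measurableSet_singleton b)), smul_eq_mul]

/-- Replacing `X` by an independent copy in `E F(S + X)` costs at most `8 √n α`, if `X` takes
`n` values and `α` bounds the strong mixing coefficient of `S` and `X`. -/
lemma abs_integral_add_sub_integral_indep_le {Ω : Type*} [MeasurableSpace Ω] {μ : Measure Ω}
    [IsProbabilityMeasure μ] {S X : Ω → ℕ} (hS : Measurable S) (hX : Measurable X) {r n : ℕ}
    (hSr : ∀ ω, S ω < r) (hXn : ∀ ω, X ω < n) {α : ℝ}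
    (hα : ∀ A B : Set ℕ,
      |μ.real (S ⁻¹' A ∩ X ⁻¹' B) - μ.real (S ⁻¹' A) * μ.real (X ⁻¹' B)| ≤ α)
    {F : ℕ → ℝ} (hF : ∀ s, |F s| ≤ 1) :
    |∫ ω, F (S ω + X ω) ∂μ
        - ∫ ω, (∑ j ∈ Finset.range n, μ.real (X ⁻¹' {j}) * F (S ω + j)) ∂μ|
      ≤ 8 * √n * α := by
  classical
  set m : ℕ → ℕ → ℝ := fun i j =>
    μ.real (S ⁻¹' {i} ∩ X ⁻¹' {j}) - μ.real (S ⁻¹' {i}) * μ.real (X ⁻¹' {j})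
  have h1 := integral_comp_eq_sum_measureReal (μ := μ) (hS.prodMk hX)
    (s := Finset.range r ×ˢ Finset.range n) (fun ω => by simp [hSr, hXn])
    (fun b : ℕ × ℕ => F (b.1 + b.2))
  have h2 := integral_comp_eq_sum_measureReal (μ := μ) hS (s := Finset.range r)
    (fun ω => by simp [hSr]) (fun i => ∑ j ∈ Finset.range n, μ.real (X ⁻¹' {j}) * F (i + j))
  have hpre : ∀ i j, (fun ω => (S ω, X ω)) ⁻¹' {(i, j)} = S ⁻¹' {i} ∩ X ⁻¹' {j} := by
    intro i j; ext ω; simp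
  simp only at h1 h2
  rw [h1, h2, Finset.sum_product]
  have h3 : (∑ i ∈ Finset.range r, ∑ j ∈ Finset.range n,
        μ.real ((fun ω => (S ω, X ω)) ⁻¹' {(i, j)}) * F (i + j))
      - ∑ i ∈ Finset.range r, μ.real (S ⁻¹' {i}) *
          ∑ j ∈ Finset.range n, μ.real (X ⁻¹' {j}) * F (i + j)
      = ∑ i ∈ Finset.range r, ∑ j ∈ Finset.range n, m i j * F (i + j) := by
    rw [← Finset.sum_sub_distrib]
    refine Finset.sum_congr rfl fun i _ => ?_
    rw [Finset.mul_sum, ← Finset.sum_sub_distrib]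
    refine Finset.sum_congr rfl fun j _ => ?_
    rw [hpre]; ring
  rw [h3]
  have hrect : ∀ A ⊆ Finset.range r, ∀ B ⊆ Finset.range n, |∑ i ∈ A, ∑ j ∈ B, m i j| ≤ α := by
    intro A _ B _
    have e1 : ∑ i ∈ A, ∑ j ∈ B, μ.real (S ⁻¹' {i} ∩ X ⁻¹' {j})
        = μ.real (S ⁻¹' A ∩ X ⁻¹' B) := by
      have := sum_measureReal_preimage_singleton (μ := μ) (A ×ˢ B)
        (f := fun ω => (S ω, X ω)) (fun b _ => (hS.prodMk hX) (measurableSet_singleton b))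
      rw [Finset.sum_product] at this
      simp_rw [hpre] at this
      rw [this]
      congr 1
      ext ω; simp
    have e2 : ∑ i ∈ A, ∑ j ∈ B, μ.real (S ⁻¹' {i}) * μ.real (X ⁻¹' {j})
        = μ.real (S ⁻¹' A) * μ.real (X ⁻¹' B) := by
      rw [← Finset.sum_mul_sum,
        sum_measureReal_preimage_singleton A (fun b _ => hS (measurableSet_singleton b)),
        sum_measureReal_preimage_singleton B (fun b _ => hX (measurableSet_singleton b))]
    have : ∑ i ∈ A, ∑ j ∈ B, m i j
        = μ.real (S ⁻¹' A ∩ X ⁻¹' B) - μ.real (S ⁻¹' A) * μ.real (X ⁻¹' B) := by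
      rw [← e1, ← e2, ← Finset.sum_sub_distrib]
      exact Finset.sum_congr rfl fun i _ => Finset.sum_sub_distrib _ _
    rw [this]
    exact hα _ _
  calc |∑ i ∈ Finset.range r, ∑ j ∈ Finset.range n, m i j * F (i + j)|
      ≤ ∑ i ∈ Finset.range r, |∑ j ∈ Finset.range n, m i j * F (i + j)| :=
        Finset.abs_sum_le_sum_abs _ _
    _ ≤ ∑ i ∈ Finset.range r, ∑ j ∈ Finset.range n, |m i j * F (i + j)| :=
        Finset.sum_le_sum fun i _ => Finset.abs_sum_le_sum_abs _ _
    _ ≤ ∑ i ∈ Finset.range r, ∑ j ∈ Finset.range n, |m i j| := by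
        refine Finset.sum_le_sum fun i _ => Finset.sum_le_sum fun j _ => ?_
        rw [abs_mul]
        exact mul_le_of_le_one_right (abs_nonneg _) (hF _)
    _ ≤ 8 * √(Finset.range n).card * α := sum_sum_abs_le_of_rectangle_sums m _ _ hrect
    _ = _ := by rw [Finset.card_range]

/-- Expectation of a function of a sum of weakly dependent variables, when the function is
dominated by an exponential: the bound for independent summands, plus the mixing error. The
summands are replaced by independent copies one at a time, starting from the last; `F` then
changes to its convolution with the law of the summand, which is dominated likewise. -/
lemma integral_sum_le_prod_exp_moment {Ω : Type*} [MeasurableSpace Ω] {μ : Measure Ω}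
    [IsProbabilityMeasure μ] {X : ℕ → Ω → ℕ} (hX : ∀ k, Measurable (X k)) {n : ℕ}
    (hXn : ∀ k ω, X k ω < n) {a : ℕ → ℝ} {q : ℕ}
    (ha : ∀ k < q, ∀ A B : Set ℕ,
      |μ.real ((fun ω => ∑ l ∈ Finset.range k, X l ω) ⁻¹' A ∩ X k ⁻¹' B)
        - μ.real ((fun ω => ∑ l ∈ Finset.range k, X l ω) ⁻¹' A) * μ.real (X k ⁻¹' B)| ≤ a k)
    {F : ℕ → ℝ} {K θ : ℝ} (hF : ∀ s, |F s| ≤ 1) (hFK : ∀ s : ℕ, F s ≤ K * Real.exp (θ * s)) :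
    ∫ ω, F (∑ k ∈ Finset.range q, X k ω) ∂μ
      ≤ K * ∏ k ∈ Finset.range q, ∫ ω, Real.exp (θ * X k ω) ∂μ
        + ∑ k ∈ Finset.range q, 8 * √n * a k := by
  induction q generalizing F K with
  | zero => simpa using hFK 0
  | succ q ih =>
    set p : ℕ → ℝ := fun j => μ.real (X q ⁻¹' {j})
    have hsum : ∑ j ∈ Finset.range n, p j = 1 := by
      rw [sum_measureReal_preimage_singleton _ fun b _ => hX q (measurableSet_singleton b)]
      have : X q ⁻¹' (Finset.range n : Finset ℕ) = Set.univ := by ext ω; simp [hXn]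
      rw [this]; simp
    have hexp : ∫ ω, Real.exp (θ * X q ω) ∂μ
        = ∑ j ∈ Finset.range n, p j * Real.exp (θ * j) :=
      integral_comp_eq_sum_measureReal (hX q) (fun ω => by simp [hXn])
        (fun j : ℕ => Real.exp (θ * j))
    have hstep := abs_integral_add_sub_integral_indep_le (μ := μ)
      (S := fun ω => ∑ l ∈ Finset.range q, X l ω) (X := X q) (r := q * n + 1)
      (Finset.measurable_sum _ fun l _ => hX l) (hX q)
      (fun ω => Nat.lt_succ_of_le (by
        simpa using Finset.sum_le_sum (s := Finset.range q) (fun l _ => (hXn l ω).le)))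
      (hXn q) (ha q (Nat.lt_succ_self q)) hF
    have hp0 : ∀ j, 0 ≤ p j := fun j => measureReal_nonneg
    have hconv := ih (fun k hk => ha k (hk.trans (Nat.lt_succ_self q)))
      (F := fun s => ∑ j ∈ Finset.range n, p j * F (s + j))
      (K := K * ∫ ω, Real.exp (θ * X q ω) ∂μ) ?_ ?_
    · simp_rw [Finset.sum_range_succ, Finset.prod_range_succ]
      have := (abs_le.1 hstep).2
      beta_reduce at this hconv
      have e : K * (∫ ω, Real.exp (θ * X q ω) ∂μ)
            * ∏ k ∈ Finset.range q, ∫ ω, Real.exp (θ * X k ω) ∂μ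
          = K * ((∏ k ∈ Finset.range q, ∫ ω, Real.exp (θ * X k ω) ∂μ)
            * ∫ ω, Real.exp (θ * X q ω) ∂μ) := by ring
      rw [e] at hconv
      linarith
    · intro s
      calc |∑ j ∈ Finset.range n, p j * F (s + j)|
          ≤ ∑ j ∈ Finset.range n, |p j * F (s + j)| := Finset.abs_sum_le_sum_abs _ _
        _ ≤ ∑ j ∈ Finset.range n, p j := by
            refine Finset.sum_le_sum fun j _ => ?_
            rw [abs_mul, abs_of_nonneg (hp0 j)]
            exact mul_le_of_le_one_right (hp0 j) (hF _)
        _ = 1 := hsum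
    · intro s
      rw [hexp, mul_assoc, Finset.sum_mul, Finset.mul_sum]
      refine Finset.sum_le_sum fun j _ => ?_
      calc p j * F (s + j) ≤ p j * (K * Real.exp (θ * ((s + j : ℕ) : ℝ))) :=
            mul_le_mul_of_nonneg_left (hFK _) (hp0 j)
        _ = K * (p j * Real.exp (θ * j) * Real.exp (θ * s)) := by
            push_cast
            rw [mul_add, Real.exp_add]; ring

/-- Chernoff's bound for sums of weakly dependent discrete variables. -/
lemma measureReal_sum_ge_le {Ω : Type*} [MeasurableSpace Ω] {μ : Measure Ω}
    [IsProbabilityMeasure μ] {X : ℕ → Ω → ℕ} (hX : ∀ k, Measurable (X k)) {n : ℕ}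
    (hXn : ∀ k ω, X k ω < n) {a : ℕ → ℝ} {q : ℕ}
    (ha : ∀ k < q, ∀ A B : Set ℕ,
      |μ.real ((fun ω => ∑ l ∈ Finset.range k, X l ω) ⁻¹' A ∩ X k ⁻¹' B)
        - μ.real ((fun ω => ∑ l ∈ Finset.range k, X l ω) ⁻¹' A) * μ.real (X k ⁻¹' B)| ≤ a k)
    (θ t : ℝ) :
    μ.real {ω | t ≤ θ * (∑ k ∈ Finset.range q, X k ω : ℕ)}
      ≤ Real.exp (-t) * ∏ k ∈ Finset.range q, ∫ ω, Real.exp (θ * X k ω) ∂μ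
        + ∑ k ∈ Finset.range q, 8 * √n * a k := by
  classical
  have h := integral_sum_le_prod_exp_moment hX hXn ha
    (F := fun s : ℕ => if t ≤ θ * s then 1 else 0) (K := Real.exp (-t)) (θ := θ) ?_ ?_
  · refine le_trans (le_of_eq ?_) h
    have hm : MeasurableSet {ω | t ≤ θ * (∑ k ∈ Finset.range q, X k ω : ℕ)} := by
      have : Measurable fun ω => ∑ k ∈ Finset.range q, X k ω :=
        Finset.measurable_sum _ fun l _ => hX l
      exact this (MeasurableSet.of_discrete (s := {s : ℕ | t ≤ θ * s}))
    have := integral_indicator_const (μ := μ) (1 : ℝ) hm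
    rw [smul_eq_mul, mul_one] at this
    rw [← this]
    exact integral_congr_ae (Eventually.of_forall fun ω => by
      simp only [Set.indicator_apply, Set.mem_ofPred_eq])
  · intro s; split_ifs <;> simp
  · intro s
    rw [← Real.exp_add]
    split_ifs with hs
    · exact Real.one_le_exp (by linarith)
    · positivity

/-! ### A Bernstein inequality for blocks of dependent variables -/

lemma integrable_of_measurable_of_abs_le {Ω : Type*} [MeasurableSpace Ω] {μ : Measure Ω}
    [IsFiniteMeasure μ] {Y : Ω → ℝ} (hY : Measurable Y) {b : ℝ} (hb : ∀ ω, |Y ω| ≤ b) :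
    Integrable Y μ :=
  Integrable.of_bound hY.aestronglyMeasurable b (Eventually.of_forall hb)

lemma integral_exp_le_of_abs_le_one {Ω : Type*} [MeasurableSpace Ω] {μ : Measure Ω}
    [IsProbabilityMeasure μ] {Y : Ω → ℝ} (hY : Measurable Y) (hY1 : ∀ ω, |Y ω| ≤ 1) {v : ℝ}
    (hv : ∫ ω, Y ω ^ 2 ∂μ ≤ v) :
    ∫ ω, Real.exp (Y ω) ∂μ ≤ Real.exp (∫ ω, Y ω ∂μ + v) := by
  have hi := integrable_of_measurable_of_abs_le (μ := μ) hY hY1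
  have hi2 : Integrable (fun ω => Y ω ^ 2) μ :=
    integrable_of_measurable_of_abs_le (hY.pow_const 2) (b := 1) fun ω => by
      rw [abs_pow]; exact pow_le_one₀ (abs_nonneg _) (hY1 ω)
  have hi1 : Integrable (fun ω => 1 + Y ω) μ := (integrable_const _).add hi
  calc ∫ ω, Real.exp (Y ω) ∂μ ≤ ∫ ω, (1 + Y ω + Y ω ^ 2) ∂μ := by
        refine integral_mono_of_nonneg (Eventually.of_forall fun _ => (Real.exp_pos _).le)
          (hi1.add hi2) (Eventually.of_forall fun ω => ?_)
        have := (abs_le.1 (Real.abs_exp_sub_one_sub_id_le (hY1 ω))).2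
        dsimp only
        linarith
    _ = 1 + ∫ ω, Y ω ∂μ + ∫ ω, Y ω ^ 2 ∂μ := by
        rw [integral_add hi1 hi2, integral_add (integrable_const _) hi]
        simp
    _ ≤ (∫ ω, Y ω ∂μ + v) + 1 := by linarith
    _ ≤ _ := Real.add_one_le_exp _

lemma integral_sum_sq_le {Ω : Type*} [MeasurableSpace Ω] {μ : Measure Ω}
    [IsProbabilityMeasure μ] {Z : ℕ → Ω → ℝ} (hZ : ∀ i, Measurable (Z i)) {b c : ℝ}
    (hZ0 : ∀ i ω, 0 ≤ Z i ω) (hZb : ∀ i ω, Z i ω ≤ b) (hb : 0 ≤ b) (hZc : ∀ i, ∫ ω, Z i ω ∂μ ≤ c)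
    (J : Finset ℕ) :
    ∫ ω, (∑ i ∈ J, Z i ω) ^ 2 ∂μ ≤ (J.card : ℝ) ^ 2 * (b * c) := by
  have hi : ∀ i, Integrable (Z i) μ := fun i =>
    integrable_of_measurable_of_abs_le (hZ i) fun ω => by
      rw [abs_of_nonneg (hZ0 i ω)]; exact hZb i ω
  calc ∫ ω, (∑ i ∈ J, Z i ω) ^ 2 ∂μ ≤ ∫ ω, (J.card : ℝ) * ∑ i ∈ J, b * Z i ω ∂μ := by
        refine integral_mono_of_nonneg (Eventually.of_forall fun _ => sq_nonneg _)
          ((integrable_finsetSum _ fun i _ => (hi i).const_mul b).const_mul _)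
          (Eventually.of_forall fun ω => ?_)
        refine (sq_sum_le_card_mul_sum_sq (s := J) (f := fun i => Z i ω)).trans ?_
        refine mul_le_mul_of_nonneg_left (Finset.sum_le_sum fun i _ => ?_) (Nat.cast_nonneg _)
        rw [sq]
        exact mul_le_mul_of_nonneg_right (hZb i ω) (hZ0 i ω)
    _ = J.card * ∑ i ∈ J, b * ∫ ω, Z i ω ∂μ := by
        rw [integral_const_mul, integral_finsetSum _ fun i _ => (hi i).const_mul b]
        simp_rw [integral_const_mul]
    _ ≤ J.card * ∑ i ∈ J, b * c := by
        gcongr with i _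
        exact hZc i
    _ = _ := by rw [Finset.sum_const, nsmul_eq_mul]; ring

lemma measurable_sigmaGen {Ω E : Type*} [mE : MeasurableSpace E] (W : ℕ → Ω → E) {s : Finset ℕ}
    {i : ℕ} (hi : i ∈ s) : Measurable[sigmaGen W s] (W i) :=
  Measurable.of_comap_le (le_iSup₂_of_le i hi le_rfl)

lemma sigmaGen_mono {Ω E : Type*} [mE : MeasurableSpace E] (W : ℕ → Ω → E) {s t : Finset ℕ}
    (h : s ⊆ t) : sigmaGen W s ≤ sigmaGen W t :=
  iSup₂_le fun i hi => le_iSup₂_of_le i (h hi) le_rfl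

lemma sigmaGen_le {Ω E : Type*} [mΩ : MeasurableSpace Ω] [mE : MeasurableSpace E] {W : ℕ → Ω → E}
    (hW : ∀ i, Measurable (W i)) (s : Finset ℕ) : sigmaGen W s ≤ mΩ :=
  iSup₂_le fun i _ => (hW i).comap_le

/-- The value `⌊(∑_{i ∈ J} φ (W i)) / ξ⌋` of a block sum discretized at scale `ξ`. -/
noncomputable def blockFloor {Ω E : Type*} (W : ℕ → Ω → E) (φ : E → ℝ) (ξ : ℝ) (J : Finset ℕ)
    (ω : Ω) : ℕ :=
  ⌊(∑ i ∈ J, φ (W i ω)) / ξ⌋₊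

lemma measurable_blockFloor {Ω E : Type*} [MeasurableSpace E] (W : ℕ → Ω → E) {φ : E → ℝ}
    (hφ : Measurable φ) (ξ : ℝ) (J : Finset ℕ) :
    Measurable[sigmaGen W J] (blockFloor W φ ξ J) := by
  let _ : MeasurableSpace Ω := sigmaGen W J
  refine Nat.measurable_floor.comp (Measurable.div_const ?_ ξ)
  exact Finset.measurable_sum _ fun i hi => hφ.comp (measurable_sigmaGen W hi)

/-- One-sided Bernstein bound for the discretized sums over a set `s` of pairwise nonadjacent
blocks: these are nearly independent, and their sums have second moments at most `|J_k|² b c`. -/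
lemma measureReal_blockFloor_sum_ge_le {Ω E : Type*} [MeasurableSpace Ω] [MeasurableSpace E]
    {μ : Measure Ω} [IsProbabilityMeasure μ] {W : ℕ → Ω → E} (hW : ∀ i, Measurable (W i))
    {φ : E → ℝ} (hφ : Measurable φ) {b c : ℝ} (hφ0 : ∀ w, 0 ≤ φ w) (hφb : ∀ w, φ w ≤ b)
    (hφc : ∀ i, ∫ ω, φ (W i ω) ∂μ ≤ c) {J : ℕ → Finset ℕ} {q : ℕ} {a : ℕ → ℝ}
    (ha0 : ∀ k, 0 ≤ a k)
    (ha : ∀ k < q, ∀ A B : Set Ω,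
      MeasurableSet[sigmaGen W ((Finset.range (k - 1)).biUnion J)] A →
      MeasurableSet[sigmaGen W (J k)] B → |μ.real (A ∩ B) - μ.real A * μ.real B| ≤ a k)
    {R V lam ξ : ℝ} (hR : ∀ k < q, ((J k).card : ℝ) ≤ R)
    (hV : ∑ k ∈ Finset.range q, ((J k).card : ℝ) ^ 2 ≤ V) (hlam : 0 < lam) (hξ : 0 < ξ)
    (hlamR : lam * (R * b) ≤ 1)
    {s : Finset ℕ} (hs : s ⊆ Finset.range q) (hsep : ∀ k ∈ s, ∀ l ∈ s, l < k → l < k - 1)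
    {σ : ℝ} (hσ : |σ| = 1) (t : ℝ) :
    μ.real {ω | t ≤ σ * lam * ξ * (∑ k ∈ s, (blockFloor W φ ξ (J k) ω : ℝ)
        - ∑ k ∈ s, ∫ ω, (blockFloor W φ ξ (J k) ω : ℝ) ∂μ)}
      ≤ Real.exp (-t + lam ^ 2 * (b * c) * V)
        + 8 * √(R * b / ξ + 1) * ∑ k ∈ Finset.range q, a k := by
  classical
  rcases Nat.eq_zero_or_pos q with rfl | hq
  · have hs' : s = ∅ := by simpa using hs
    subst hs'
    have hVn : 0 ≤ V := by simpa using hV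
    obtain ⟨ω₀⟩ : Nonempty Ω := (inferInstance : (ae μ).NeBot).nonempty
    have hbn : 0 ≤ b := (hφ0 _).trans (hφb (W 0 ω₀))
    have hcn : 0 ≤ c := (integral_nonneg fun ω => hφ0 _).trans (hφc 0)
    simp only [Finset.sum_empty, sub_zero, mul_zero, Finset.range_zero, add_zero]
    by_cases ht : t ≤ 0
    · refine measureReal_le_one.trans (Real.one_le_exp ?_)
      have : 0 ≤ lam ^ 2 * (b * c) * V := by positivity
      linarith
    · simp [ht, (Real.exp_pos _).le]
  obtain ⟨ω₀⟩ : Nonempty Ω := (inferInstance : (ae μ).NeBot).nonempty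
  have hb : 0 ≤ b := (hφ0 _).trans (hφb (W 0 ω₀))
  have hc : 0 ≤ c := (integral_nonneg fun ω => hφ0 _).trans (hφc 0)
  have hR0 : 0 ≤ R := (Nat.cast_nonneg _).trans (hR 0 hq)
  have hT0 : ∀ k ω, 0 ≤ ∑ i ∈ J k, φ (W i ω) := fun k ω => Finset.sum_nonneg fun i _ => hφ0 _
  have hTb : ∀ k < q, ∀ ω, ∑ i ∈ J k, φ (W i ω) ≤ R * b := by
    intro k hk ω
    calc ∑ i ∈ J k, φ (W i ω) ≤ ∑ i ∈ J k, b := Finset.sum_le_sum fun i _ => hφb _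
      _ = (J k).card * b := by rw [Finset.sum_const, nsmul_eq_mul]
      _ ≤ R * b := by gcongr; exact hR k hk
  have hξX : ∀ k ω, ξ * blockFloor W φ ξ (J k) ω ≤ ∑ i ∈ J k, φ (W i ω) := by
    intro k ω
    have := Nat.floor_le (div_nonneg (hT0 k ω) hξ.le)
    rw [le_div_iff₀ hξ] at this
    rw [mul_comm]; exact this
  -- outside `s` the summands are constant, hence independent of everything
  set X : ℕ → Ω → ℕ := fun k ω => if k ∈ s then blockFloor W φ ξ (J k) ω else 0 with hXdef
  have hXmem : ∀ k ∈ s, X k = blockFloor W φ ξ (J k) := fun k hk => by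
    funext ω; simp [hXdef, hk]
  have hXnot : ∀ k ∉ s, X k = fun _ => 0 := fun k hk => by funext ω; simp [hXdef, hk]
  have hXm : ∀ k, Measurable (X k) := by
    intro k
    by_cases hk : k ∈ s
    · rw [hXmem k hk]
      exact (measurable_blockFloor W hφ ξ (J k)).mono (sigmaGen_le hW _) le_rfl
    · rw [hXnot k hk]; exact measurable_const
  set n : ℕ := ⌊R * b / ξ⌋₊ + 1 with hn
  have hXn : ∀ k ω, X k ω < n := by
    intro k ω
    by_cases hk : k ∈ s
    · rw [hXmem k hk]
      refine Nat.lt_succ_of_le (Nat.floor_le_floor ?_)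
      have := hTb k (Finset.mem_range.1 (hs hk)) ω
      gcongr
    · rw [hXnot k hk]; exact Nat.succ_pos _
  have hmix : ∀ k < q, ∀ A B : Set ℕ,
      |μ.real ((fun ω => ∑ l ∈ Finset.range k, X l ω) ⁻¹' A ∩ X k ⁻¹' B)
        - μ.real ((fun ω => ∑ l ∈ Finset.range k, X l ω) ⁻¹' A) * μ.real (X k ⁻¹' B)| ≤ a k := by
    intro k hkq A B
    by_cases hk : k ∈ s
    · refine ha k hkq _ _ ?_ ?_
      · have : Measurable[sigmaGen W ((Finset.range (k - 1)).biUnion J)]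
            (fun ω => ∑ l ∈ Finset.range k, X l ω) := by
          let _ : MeasurableSpace Ω := sigmaGen W ((Finset.range (k - 1)).biUnion J)
          refine Finset.measurable_sum _ fun l hl => ?_
          by_cases hls : l ∈ s
          · rw [hXmem l hls]
            refine (measurable_blockFloor W hφ ξ (J l)).mono (sigmaGen_mono W ?_) le_rfl
            exact Finset.subset_biUnion_of_mem J
              (Finset.mem_range.2 (hsep k hk l hls (Finset.mem_range.1 hl)))
          · rw [hXnot l hls]; exact measurable_const
        exact this MeasurableSet.of_discrete
      · rw [hXmem k hk]
        exact measurable_blockFloor W hφ ξ (J k) MeasurableSet.of_discrete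
    · rw [hXnot k hk]
      by_cases h0 : (0 : ℕ) ∈ B
      · simp [h0, ha0 k]
      · simp [h0, ha0 k]
  have hsumX : ∀ ω, ((∑ k ∈ Finset.range q, X k ω : ℕ) : ℝ)
      = ∑ k ∈ s, (blockFloor W φ ξ (J k) ω : ℝ) := by
    intro ω
    push_cast
    rw [← Finset.sum_subset hs]
    · exact Finset.sum_congr rfl fun k hk => by rw [hXmem k hk]
    · intro k _ hk; simp [hXnot k hk]
  set m : ℕ → ℝ := fun k => ∫ ω, (blockFloor W φ ξ (J k) ω : ℝ) ∂μ
  have hmom : ∀ k ∈ s, ∫ ω, Real.exp (σ * lam * ξ * X k ω) ∂μ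
      ≤ Real.exp (σ * lam * ξ * m k + lam ^ 2 * (b * c) * ((J k).card : ℝ) ^ 2) := by
    intro k hk
    have hkq := Finset.mem_range.1 (hs hk)
    rw [hXmem k hk]
    have hmeas : Measurable fun ω => (blockFloor W φ ξ (J k) ω : ℝ) :=
      measurable_from_nat.comp
        ((measurable_blockFloor W hφ ξ (J k)).mono (sigmaGen_le hW _) le_rfl)
    have habs : ∀ ω, |σ * lam * ξ * (blockFloor W φ ξ (J k) ω : ℝ)|
        ≤ lam * ∑ i ∈ J k, φ (W i ω) := by
      intro ω
      rw [mul_assoc, mul_assoc, abs_mul, hσ, one_mul, abs_of_nonneg (by positivity)]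
      exact mul_le_mul_of_nonneg_left (hξX k ω) hlam.le
    have h1 : ∀ ω, |σ * lam * ξ * (blockFloor W φ ξ (J k) ω : ℝ)| ≤ 1 := fun ω =>
      (habs ω).trans ((mul_le_mul_of_nonneg_left (hTb k hkq ω) hlam.le).trans hlamR)
    have h2 : ∫ ω, (σ * lam * ξ * (blockFloor W φ ξ (J k) ω : ℝ)) ^ 2 ∂μ
        ≤ lam ^ 2 * (b * c) * ((J k).card : ℝ) ^ 2 := by
      have hTm : Measurable fun ω => ∑ i ∈ J k, φ (W i ω) :=
        Finset.measurable_sum _ fun i _ => hφ.comp (hW i)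
      calc ∫ ω, (σ * lam * ξ * (blockFloor W φ ξ (J k) ω : ℝ)) ^ 2 ∂μ
          ≤ ∫ ω, lam ^ 2 * (∑ i ∈ J k, φ (W i ω)) ^ 2 ∂μ := by
            refine integral_mono_of_nonneg (Eventually.of_forall fun _ => sq_nonneg _) ?_
              (Eventually.of_forall fun ω => ?_)
            · refine (integrable_of_measurable_of_abs_le (hTm.pow_const 2)
                (b := (R * b) ^ 2) fun ω => ?_).const_mul _
              rw [abs_of_nonneg (sq_nonneg _)]
              exact pow_le_pow_left₀ (hT0 k ω) (hTb k hkq ω) 2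
            · dsimp only
              rw [← sq_abs, ← mul_pow]
              exact pow_le_pow_left₀ (abs_nonneg _) (habs ω) 2
        _ = lam ^ 2 * ∫ ω, (∑ i ∈ J k, φ (W i ω)) ^ 2 ∂μ := integral_const_mul _ _
        _ ≤ lam ^ 2 * (((J k).card : ℝ) ^ 2 * (b * c)) := by
            gcongr
            exact integral_sum_sq_le (fun i => hφ.comp (hW i)) (fun i ω => hφ0 _)
              (fun i ω => hφb _) hb hφc (J k)
        _ = _ := by ring
    have := integral_exp_le_of_abs_le_one (μ := μ) (hmeas.const_mul (σ * lam * ξ)) h1 h2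
    rwa [integral_const_mul] at this
  have hprod : ∏ k ∈ Finset.range q, ∫ ω, Real.exp (σ * lam * ξ * X k ω) ∂μ
      ≤ Real.exp (σ * lam * ξ * ∑ k ∈ s, m k + lam ^ 2 * (b * c) * V) := by
    rw [← Finset.prod_subset hs]
    · calc ∏ k ∈ s, ∫ ω, Real.exp (σ * lam * ξ * X k ω) ∂μ
          ≤ ∏ k ∈ s, Real.exp (σ * lam * ξ * m k + lam ^ 2 * (b * c) * ((J k).card : ℝ) ^ 2) :=
            Finset.prod_le_prod (fun k _ => integral_nonneg fun _ => (Real.exp_pos _).le) hmom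
        _ = Real.exp (σ * lam * ξ * ∑ k ∈ s, m k
              + lam ^ 2 * (b * c) * ∑ k ∈ s, ((J k).card : ℝ) ^ 2) := by
            rw [← Real.exp_sum, Finset.sum_add_distrib, ← Finset.mul_sum, ← Finset.mul_sum]
        _ ≤ _ := by
            gcongr
            exact (Finset.sum_le_sum_of_subset_of_nonneg hs fun _ _ _ => sq_nonneg _).trans hV
    · intro k _ hk; simp [hXnot k hk]
  have hmain := measureReal_sum_ge_le hXm hXn hmix (σ * lam * ξ)
    (t + σ * lam * ξ * ∑ k ∈ s, m k)
  have hset : {ω | t + σ * lam * ξ * ∑ k ∈ s, m k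
      ≤ σ * lam * ξ * (∑ k ∈ Finset.range q, X k ω : ℕ)}
      = {ω | t ≤ σ * lam * ξ * (∑ k ∈ s, (blockFloor W φ ξ (J k) ω : ℝ) - ∑ k ∈ s, m k)} := by
    ext ω
    simp only [Set.mem_ofPred_eq]
    rw [hsumX, mul_sub, le_sub_iff_add_le]
  rw [hset] at hmain
  refine hmain.trans (add_le_add ?_ ?_)
  · calc Real.exp (-(t + σ * lam * ξ * ∑ k ∈ s, m k))
          * ∏ k ∈ Finset.range q, ∫ ω, Real.exp (σ * lam * ξ * X k ω) ∂μ
        ≤ Real.exp (-(t + σ * lam * ξ * ∑ k ∈ s, m k))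
          * Real.exp (σ * lam * ξ * ∑ k ∈ s, m k + lam ^ 2 * (b * c) * V) := by gcongr
      _ = _ := by rw [← Real.exp_add]; congr 1; ring
  · rw [← Finset.mul_sum]
    have hsqrt : √(n : ℝ) ≤ √(R * b / ξ + 1) := by
      apply Real.sqrt_le_sqrt
      rw [hn]; push_cast
      have := Nat.floor_le (show 0 ≤ R * b / ξ by positivity)
      linarith
    have : 0 ≤ ∑ k ∈ Finset.range q, a k := Finset.sum_nonneg fun k _ => ha0 k
    gcongr

/-- Bernstein's inequality for a sum over blocks, each of which is nearly independent of the
blocks before the previous one: the blocks of even and of odd number are treated separately, after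
discretizing the block sums at scale `ξ`. -/
lemma measureReal_abs_block_sum_ge_le {Ω E : Type*} [MeasurableSpace Ω] [MeasurableSpace E]
    {μ : Measure Ω} [IsProbabilityMeasure μ] {W : ℕ → Ω → E} (hW : ∀ i, Measurable (W i))
    {φ : E → ℝ} (hφ : Measurable φ) {b c : ℝ} (hφ0 : ∀ w, 0 ≤ φ w) (hφb : ∀ w, φ w ≤ b)
    (hφc : ∀ i, ∫ ω, φ (W i ω) ∂μ ≤ c) {J : ℕ → Finset ℕ} {q : ℕ} {a : ℕ → ℝ}
    (ha0 : ∀ k, 0 ≤ a k)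
    (ha : ∀ k < q, ∀ A B : Set Ω,
      MeasurableSet[sigmaGen W ((Finset.range (k - 1)).biUnion J)] A →
      MeasurableSet[sigmaGen W (J k)] B → |μ.real (A ∩ B) - μ.real A * μ.real B| ≤ a k)
    {R V lam ξ : ℝ} (hR : ∀ k < q, ((J k).card : ℝ) ≤ R)
    (hV : ∑ k ∈ Finset.range q, ((J k).card : ℝ) ^ 2 ≤ V) (hlam : 0 < lam) (hξ : 0 < ξ)
    (hlamR : lam * (R * b) ≤ 1) (t : ℝ) :
    μ.real {ω | 2 * (t / lam) + q * ξ
        ≤ |∑ k ∈ Finset.range q, ∑ i ∈ J k, (φ (W i ω) - ∫ ω, φ (W i ω) ∂μ)|}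
      ≤ 4 * (Real.exp (-t + lam ^ 2 * (b * c) * V)
        + 8 * √(R * b / ξ + 1) * ∑ k ∈ Finset.range q, a k) := by
  classical
  set s : Bool → Finset ℕ := fun e => (Finset.range q).filter fun k => k.bodd = e with hsdef
  set D : Bool → Ω → ℝ := fun e ω => ∑ k ∈ s e, (blockFloor W φ ξ (J k) ω : ℝ)
        - ∑ k ∈ s e, ∫ ω, (blockFloor W φ ξ (J k) ω : ℝ) ∂μ with hD
  set Bd := Real.exp (-t + lam ^ 2 * (b * c) * V)
        + 8 * √(R * b / ξ + 1) * ∑ k ∈ Finset.range q, a k with hBd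
  have hone : ∀ e : Bool, ∀ σ : ℝ, |σ| = 1 →
      μ.real {ω | t ≤ σ * lam * ξ * D e ω} ≤ Bd := by
    intro e σ hσ
    refine measureReal_blockFloor_sum_ge_le hW hφ hφ0 hφb hφc ha0 ha hR hV hlam hξ hlamR
      (Finset.filter_subset _ _) ?_ hσ t
    intro k hk l hl hlk
    have h1 := (Finset.mem_filter.1 hk).2
    have h2 := (Finset.mem_filter.1 hl).2
    have : l + 1 ≠ k := by
      rintro rfl
      rw [Nat.bodd_succ, h2] at h1
      cases e <;> simp at h1
    omega
  have hT0 : ∀ k ω, 0 ≤ ∑ i ∈ J k, φ (W i ω) := fun k ω => Finset.sum_nonneg fun i _ => hφ0 _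
  have hZi : ∀ i, Integrable (fun ω => φ (W i ω)) μ := fun i =>
    integrable_of_measurable_of_abs_le (b := b) (hφ.comp (hW i)) fun ω => by
      rw [abs_of_nonneg (hφ0 _)]; exact hφb _
  have hTi : ∀ k, Integrable (fun ω => ∑ i ∈ J k, φ (W i ω)) μ := fun k =>
    integrable_finsetSum _ fun i _ => hZi i
  have hlow : ∀ k ω, ξ * blockFloor W φ ξ (J k) ω ≤ ∑ i ∈ J k, φ (W i ω) := by
    intro k ω
    have := Nat.floor_le (div_nonneg (hT0 k ω) hξ.le)
    rw [le_div_iff₀ hξ] at this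
    rw [mul_comm]; exact this
  have hup : ∀ k ω, ∑ i ∈ J k, φ (W i ω) ≤ ξ * blockFloor W φ ξ (J k) ω + ξ := by
    intro k ω
    have := (Nat.lt_floor_add_one ((∑ i ∈ J k, φ (W i ω)) / ξ)).le
    rw [div_le_iff₀ hξ] at this
    calc _ ≤ _ := this
      _ = _ := by rw [blockFloor]; ring
  have hXi : ∀ k, Integrable (fun ω => ξ * (blockFloor W φ ξ (J k) ω : ℝ)) μ := by
    intro k
    have hm : Measurable fun ω => (blockFloor W φ ξ (J k) ω : ℝ) :=
      measurable_from_nat.comp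
        ((measurable_blockFloor W hφ ξ (J k)).mono (sigmaGen_le hW _) le_rfl)
    refine (hTi k).mono' (hm.const_mul ξ).aestronglyMeasurable (Eventually.of_forall fun ω => ?_)
    rw [Real.norm_of_nonneg (by positivity)]
    exact hlow k ω
  set ET : ℕ → ℝ := fun k => ∑ i ∈ J k, ∫ ω, φ (W i ω) ∂μ
  have hET : ∀ k, ET k = ∫ ω, ∑ i ∈ J k, φ (W i ω) ∂μ := fun k =>
    (integral_finsetSum _ fun i _ => hZi i).symm
  have hEl : ∀ k, ξ * ∫ ω, (blockFloor W φ ξ (J k) ω : ℝ) ∂μ ≤ ET k := by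
    intro k
    rw [hET, ← integral_const_mul]
    exact integral_mono (hXi k) (hTi k) (hlow k)
  have hEu : ∀ k, ET k ≤ ξ * ∫ ω, (blockFloor W φ ξ (J k) ω : ℝ) ∂μ + ξ := by
    intro k
    rw [hET, ← integral_const_mul]
    refine (integral_mono (hTi k) ((hXi k).add (integrable_const ξ)) (hup k)).trans ?_
    simp only [Pi.add_apply]
    rw [integral_add (hXi k) (integrable_const ξ)]
    simp
  have hdiff : ∀ e ω, |∑ k ∈ s e, (∑ i ∈ J k, φ (W i ω) - ET k)|
      ≤ ξ * |D e ω| + (s e).card * ξ := by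
    intro e ω
    have : ∑ k ∈ s e, (∑ i ∈ J k, φ (W i ω) - ET k)
        = ξ * D e ω + ∑ k ∈ s e, ((∑ i ∈ J k, φ (W i ω) - ET k)
          - (ξ * blockFloor W φ ξ (J k) ω - ξ * ∫ ω, (blockFloor W φ ξ (J k) ω : ℝ) ∂μ)) := by
      rw [hD]
      simp only [Finset.sum_sub_distrib, ← Finset.mul_sum]
      ring
    rw [this]
    refine (abs_add_le _ _).trans (add_le_add ?_ ?_)
    · rw [abs_mul, abs_of_pos hξ]
    · refine (Finset.abs_sum_le_sum_abs _ _).trans ?_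
      rw [← nsmul_eq_mul]
      refine Finset.sum_le_card_nsmul _ _ _ fun k _ => ?_
      rw [abs_le]
      constructor <;> linarith [hlow k ω, hup k ω, hEl k, hEu k]
  have hsplit : ∀ ω, ∑ k ∈ Finset.range q, ∑ i ∈ J k, (φ (W i ω) - ∫ ω, φ (W i ω) ∂μ)
      = ∑ k ∈ s true, (∑ i ∈ J k, φ (W i ω) - ET k)
        + ∑ k ∈ s false, (∑ i ∈ J k, φ (W i ω) - ET k) := by
    intro ω
    simp_rw [Finset.sum_sub_distrib (f := fun i => φ (W i ω))]
    rw [← Finset.sum_filter_add_sum_filter_not (Finset.range q) (fun k => k.bodd = true)]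
    simp only [Bool.not_eq_true]
    rfl
  have hcard : ((s true).card : ℝ) + (s false).card = q := by
    have := Finset.card_filter_add_card_filter_not (s := Finset.range q)
      (fun k => k.bodd = true)
    simp only [Bool.not_eq_true, Finset.card_range] at this
    exact_mod_cast this
  have hsub : {ω | 2 * (t / lam) + q * ξ
        ≤ |∑ k ∈ Finset.range q, ∑ i ∈ J k, (φ (W i ω) - ∫ ω, φ (W i ω) ∂μ)|}
      ⊆ ({ω | t ≤ 1 * lam * ξ * D true ω} ∪ {ω | t ≤ -1 * lam * ξ * D true ω})
        ∪ ({ω | t ≤ 1 * lam * ξ * D false ω} ∪ {ω | t ≤ -1 * lam * ξ * D false ω}) := by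
    intro ω hω
    by_contra hcon
    simp only [Set.mem_union, Set.mem_ofPred_eq, not_or, not_le] at hcon hω
    obtain ⟨⟨h1, h2⟩, h3, h4⟩ := hcon
    have e1 : ξ * |D true ω| < t / lam := by
      rw [lt_div_iff₀ hlam, ← abs_of_pos hξ, ← abs_mul, ← abs_of_pos hlam, ← abs_mul,
        abs_lt]
      constructor <;> nlinarith
    have e2 : ξ * |D false ω| < t / lam := by
      rw [lt_div_iff₀ hlam, ← abs_of_pos hξ, ← abs_mul, ← abs_of_pos hlam, ← abs_mul,
        abs_lt]
      constructor <;> nlinarith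
    rw [hsplit] at hω
    have := abs_add_le (∑ k ∈ s true, (∑ i ∈ J k, φ (W i ω) - ET k))
      (∑ k ∈ s false, (∑ i ∈ J k, φ (W i ω) - ET k))
    have d1 := hdiff true ω
    have d2 := hdiff false ω
    have : ((s true).card : ℝ) * ξ + (s false).card * ξ = q * ξ := by rw [← add_mul, hcard]
    linarith
  have hp := hone true 1 (by simp)
  have hm := hone true (-1) (by simp)
  have hp' := hone false 1 (by simp)
  have hm' := hone false (-1) (by simp)
  calc _ ≤ _ := measureReal_mono hsub
    _ ≤ _ := measureReal_union_le _ _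
    _ ≤ _ := add_le_add (measureReal_union_le _ _) (measureReal_union_le _ _)
    _ ≤ (Bd + Bd) + (Bd + Bd) := add_le_add (add_le_add hp hm) (add_le_add hp' hm')
    _ = 4 * Bd := by ring

/-! ### The greedy partition and its dependence coefficients -/

lemma coveredBefore_succ (Δ I : ℕ → Finset ℕ) (k : ℕ) :
    coveredBefore Δ I (k + 1) = coveredBefore Δ I k ∪ blockAt Δ I k := by
  classical
  rw [blockAt, Finset.union_sdiff_self_eq_union, coveredBefore, coveredBefore,
    Finset.range_add_one, Finset.biUnion_insert, Finset.union_comm]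

lemma sum_coveredBefore (Δ I : ℕ → Finset ℕ) (q : ℕ) (g : ℕ → ℝ) :
    ∑ i ∈ coveredBefore Δ I q, g i = ∑ k ∈ Finset.range q, ∑ i ∈ blockAt Δ I k, g i := by
  induction q with
  | zero => simp [coveredBefore]
  | succ q ih =>
    rw [coveredBefore_succ, Finset.sum_union, ih, Finset.sum_range_succ]
    exact Finset.disjoint_sdiff

namespace IsGreedyPartition

variable {N M q : ℕ} {Δ I : ℕ → Finset ℕ}

lemma sum_range_eq (h : IsGreedyPartition N Δ M q I) (g : ℕ → ℝ) :
    ∑ i ∈ Finset.range N, g i = ∑ k ∈ Finset.range q, ∑ i ∈ blockAt Δ I k, g i := by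
  rw [← sum_coveredBefore, h.covers]

lemma chosen_subset (h : IsGreedyPartition N Δ M q I) (hN : 1 ≤ N) {k : ℕ} (hk : k < q) :
    I k ⊆ Finset.range N := by
  rcases Nat.eq_zero_or_pos k with rfl | hk0
  · rw [h.first]
    exact Finset.singleton_subset_iff.2 (Finset.mem_range.2 hN)
  · intro i hi
    exact (Finset.mem_sdiff.1 (h.maximal k hk0 hk i hi).1).1

lemma chosen_disjoint (h : IsGreedyPartition N Δ M q I) (hN : 1 ≤ N)
    (hself : ∀ i < N, i ∈ Δ i) :
    (Finset.range q : Set ℕ).PairwiseDisjoint I := by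
  have key : ∀ l k, l < k → k < q → Disjoint (I l) (I k) := by
    intro l k hlk hk
    rw [Finset.disjoint_left]
    intro i hil hik
    have hiN := Finset.mem_range.1 (h.chosen_subset hN hk hik)
    refine (Finset.mem_sdiff.1 (h.maximal k (by omega) hk i hik).1).2 ?_
    rw [coveredBefore, Finset.mem_biUnion]
    exact ⟨l, Finset.mem_range.2 hlk, Finset.mem_biUnion.2 ⟨i, hil, hself i hiN⟩⟩
  intro l hl k hk hlk
  simp only [Finset.coe_range, Set.mem_Iio] at hl hk
  rcases lt_or_gt_of_ne hlk with h1 | h1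
  · exact key l k h1 hk
  · exact (key k l h1 hl).symm

lemma sum_chosen_le (h : IsGreedyPartition N Δ M q I) (hN : 1 ≤ N)
    (hself : ∀ i < N, i ∈ Δ i) {g : ℕ → ℝ} (hg : ∀ i, 0 ≤ g i) :
    ∑ k ∈ Finset.range q, ∑ i ∈ I k, g i ≤ ∑ i ∈ Finset.range N, g i := by
  classical
  rw [← Finset.sum_biUnion (h.chosen_disjoint hN hself)]
  refine Finset.sum_le_sum_of_subset_of_nonneg ?_ fun i _ _ => hg i
  exact Finset.biUnion_subset.2 fun k hk => h.chosen_subset hN (Finset.mem_range.1 hk)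

lemma number_of_blocks_le (h : IsGreedyPartition N Δ M q I) (hN : 1 ≤ N)
    (hself : ∀ i < N, i ∈ Δ i) : q ≤ N := by
  have h1 := h.sum_chosen_le hN hself (g := fun _ => 1) fun _ => zero_le_one
  have h2 : (q : ℝ) ≤ ∑ k ∈ Finset.range q, ∑ i ∈ I k, (1 : ℝ) := by
    have : ∑ k ∈ Finset.range q, (1 : ℝ) ≤ ∑ k ∈ Finset.range q, ∑ i ∈ I k, (1 : ℝ) := by
      refine Finset.sum_le_sum fun k hk => ?_
      rw [Finset.sum_const, nsmul_eq_mul, mul_one]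
      exact_mod_cast (h.nonempty k (Finset.mem_range.1 hk)).card_pos
    simpa using this
  have h3 := h2.trans h1
  simp only [Finset.sum_const, Finset.card_range, nsmul_eq_mul, mul_one] at h3
  exact_mod_cast h3

lemma card_blockAt_le_sum (Δ I : ℕ → Finset ℕ) (k : ℕ) :
    ((blockAt Δ I k).card : ℝ) ≤ ∑ i ∈ I k, ((Δ i).card : ℝ) := by
  have : (blockAt Δ I k).card ≤ ∑ i ∈ I k, (Δ i).card :=
    (Finset.card_le_card Finset.sdiff_subset).trans Finset.card_biUnion_le
  exact_mod_cast this

lemma card_blockAt_le (h : IsGreedyPartition N Δ M q I) (hN : 1 ≤ N) {k : ℕ} (hk : k < q) :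
    ((blockAt Δ I k).card : ℝ)
      ≤ M * (((Finset.range N).sup fun i => (Δ i).card : ℕ) : ℝ) := by
  refine (card_blockAt_le_sum Δ I k).trans ?_
  have : ∑ i ∈ I k, (Δ i).card ≤ M * (Finset.range N).sup fun i => (Δ i).card := by
    refine (Finset.sum_le_card_nsmul (I k) _ ((Finset.range N).sup fun i => (Δ i).card)
      fun i hi => ?_).trans ?_
    · exact Finset.le_sup (f := fun i => (Δ i).card) (h.chosen_subset hN hk hi)
    · rw [smul_eq_mul]
      exact Nat.mul_le_mul_right _ (h.card_le k hk)
  exact_mod_cast this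

lemma sum_card_blockAt_sq_le (h : IsGreedyPartition N Δ M q I) (hN : 1 ≤ N)
    (hself : ∀ i < N, i ∈ Δ i) :
    ∑ k ∈ Finset.range q, ((blockAt Δ I k).card : ℝ) ^ 2
      ≤ M * ∑ i ∈ Finset.range N, ((Δ i).card : ℝ) ^ 2 := by
  calc ∑ k ∈ Finset.range q, ((blockAt Δ I k).card : ℝ) ^ 2
      ≤ ∑ k ∈ Finset.range q, M * ∑ i ∈ I k, ((Δ i).card : ℝ) ^ 2 := by
        refine Finset.sum_le_sum fun k hk => ?_
        calc ((blockAt Δ I k).card : ℝ) ^ 2 ≤ (∑ i ∈ I k, ((Δ i).card : ℝ)) ^ 2 := by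
              gcongr
              exact card_blockAt_le_sum Δ I k
          _ ≤ (I k).card * ∑ i ∈ I k, ((Δ i).card : ℝ) ^ 2 := sq_sum_le_card_mul_sum_sq
          _ ≤ M * ∑ i ∈ I k, ((Δ i).card : ℝ) ^ 2 := by
              gcongr
              exact h.card_le k (Finset.mem_range.1 hk)
    _ = M * ∑ k ∈ Finset.range q, ∑ i ∈ I k, ((Δ i).card : ℝ) ^ 2 := by rw [Finset.mul_sum]
    _ ≤ _ := by
        gcongr
        exact h.sum_chosen_le hN hself fun i => sq_nonneg _

end IsGreedyPartition

lemma abs_sub_le_strongMixingCoeff {Ω : Type*} (𝒜 ℬ : MeasurableSpace Ω) [MeasurableSpace Ω]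
    (μ : Measure Ω) [IsProbabilityMeasure μ] {A B : Set Ω} (hA : MeasurableSet[𝒜] A)
    (hB : MeasurableSet[ℬ] B) :
    |μ.real (A ∩ B) - μ.real A * μ.real B| ≤ strongMixingCoeff μ 𝒜 ℬ := by
  refine le_ciSup (f := fun AB : {A : Set Ω // MeasurableSet[𝒜] A} ×
    {B : Set Ω // MeasurableSet[ℬ] B} =>
    |μ.real (AB.1.1 ∩ AB.2.1) - μ.real AB.1.1 * μ.real AB.2.1|) ?_ (⟨A, hA⟩, ⟨B, hB⟩)
  refine ⟨1, ?_⟩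
  rintro _ ⟨AB, rfl⟩
  have h1 : μ.real (AB.1.1 ∩ AB.2.1) ≤ 1 := measureReal_le_one
  have h2 : μ.real AB.1.1 * μ.real AB.2.1 ≤ 1 :=
    mul_le_one₀ measureReal_le_one measureReal_nonneg measureReal_le_one
  have h3 : 0 ≤ μ.real (AB.1.1 ∩ AB.2.1) := measureReal_nonneg
  have h4 : 0 ≤ μ.real AB.1.1 * μ.real AB.2.1 := mul_nonneg measureReal_nonneg measureReal_nonneg
  exact abs_le.2 ⟨by linarith, by linarith⟩

lemma blockDependence_nonneg {Ω E : Type*} [MeasurableSpace Ω] [MeasurableSpace E]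
    (μ : Measure Ω) (W : ℕ → Ω → E) (Δ I : ℕ → Finset ℕ) (k : ℕ) :
    0 ≤ blockDependence μ W Δ I k :=
  Real.iSup_nonneg fun _ => abs_nonneg _

/-! ### Extending a density by zero -/

lemma abs_second_difference_le {E : Type*} [NormedAddCommGroup E] [NormedSpace ℝ E] {g : E → ℝ}
    (hg : ContDiff ℝ 2 g) {C : ℝ} (hC : ∀ w, ‖iteratedFDeriv ℝ 2 g w‖ ≤ C) (w v : E) :
    |g (w + v) + g (w - v) - 2 * g w| ≤ 2 * C * ‖v‖ ^ 2 := by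
  have hC0 : 0 ≤ C := (norm_nonneg _).trans (hC w)
  have hd : Differentiable ℝ g := hg.differentiable (by norm_num)
  have hd' : Differentiable ℝ (fderiv ℝ g) :=
    (hg.fderiv_right (m := 1) (by norm_num)).differentiable (by norm_num)
  have hlip : ∀ x y, ‖fderiv ℝ g x - fderiv ℝ g y‖ ≤ C * ‖x - y‖ := fun x y =>
    convex_univ.norm_image_sub_le_of_norm_fderiv_le (fun z _ => hd' z) (fun z _ => by
      have := hC z
      rwa [← norm_iteratedFDeriv_fderiv, norm_iteratedFDeriv_one] at this)
      (Set.mem_univ y) (Set.mem_univ x)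
  have hder : ∀ t : ℝ, HasDerivAt (fun t : ℝ => g (w + t • v) + g (w - t • v))
      (fderiv ℝ g (w + t • v) v - fderiv ℝ g (w - t • v) v) t := by
    intro t
    have hv : HasDerivAt (fun t : ℝ => t • v) v t := by
      simpa using (hasDerivAt_id t).smul_const v
    have h1 : HasDerivAt (fun t : ℝ => g (w + t • v)) (fderiv ℝ g (w + t • v) v) t :=
      (hd _).hasFDerivAt.comp_hasDerivAt t (hv.const_add w)
    have h2 : HasDerivAt (fun t : ℝ => g (w - t • v)) (fderiv ℝ g (w - t • v) (-v)) t :=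
      (hd _).hasFDerivAt.comp_hasDerivAt t (hv.const_sub w)
    rw [map_neg] at h2
    rw [sub_eq_add_neg]
    exact h1.add h2
  have := norm_image_sub_le_of_norm_deriv_le_segment_01'
    (f := fun t : ℝ => g (w + t • v) + g (w - t • v)) (C := 2 * C * ‖v‖ ^ 2)
    (fun t _ => (hder t).hasDerivWithinAt) (fun t ht => by
      rw [← _root_.sub_apply]
      refine (ContinuousLinearMap.le_opNorm _ _).trans ?_
      have h1 := hlip (w + t • v) (w - t • v)
      have h2 : ‖w + t • v - (w - t • v)‖ ≤ 2 * ‖v‖ := by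
        have : w + t • v - (w - t • v) = (2 * t) • v := by
          rw [mul_smul, two_smul]; abel
        rw [this, norm_smul, Real.norm_of_nonneg (by linarith [ht.1])]
        have := norm_nonneg v
        nlinarith [ht.2]
      calc _ ≤ C * (2 * ‖v‖) * ‖v‖ := by
            refine mul_le_mul_of_nonneg_right (h1.trans ?_) (norm_nonneg _)
            exact mul_le_mul_of_nonneg_left h2 hC0
        _ = _ := by ring)
  simp only [one_smul, zero_smul, add_zero, sub_zero, Real.norm_eq_abs] at this
  rwa [two_mul]

/-- A density `f` which vanishes almost everywhere outside the compact set `L '' T`, and whose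
pullback by the linear map `L` (with section `s`) is `C²` with bounded derivatives near `T`, agrees
almost everywhere and on `L '' T` with a continuous function having bounded second differences.
The function is `f` extended by zero: by continuity, `f` already vanishes on the part of the
neighbourhood that lies outside `L '' T`, so the extension is `C²` on the whole space. -/
lemma exists_extension_bounded_second_difference {n m : ℕ}
    (L : (Fin n → ℝ) →L[ℝ] (Fin m → ℝ)) (s : (Fin m → ℝ) →L[ℝ] (Fin n → ℝ))
    (hLs : ∀ z, L (s z) = z) (hs : ∀ z, ‖s z‖ ≤ ‖z‖) {T U : Set (Fin n → ℝ)} (hT : IsCompact T)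
    (hU : IsOpen U) (hTU : T ⊆ U) {f : (Fin m → ℝ) → ℝ} (hf0 : ∀ z, 0 ≤ f z)
    (hfT : ∀ᵐ z, z ∉ L '' T → f z = 0) {C : ℝ} (hC : 0 ≤ C)
    (hfU : ContDiffOn ℝ 2 (fun w => f (L w)) U)
    (hfC : ∀ w ∈ U, ∀ k : ℕ, k ≤ 2 → ‖iteratedFDeriv ℝ k (fun w => f (L w)) w‖ ≤ C) :
    ∃ g : (Fin m → ℝ) → ℝ, Continuous g ∧ f =ᵐ[volume] g ∧ (∀ z ∈ L '' T, f z = g z) ∧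
      (∀ z, 0 ≤ g z) ∧ (∀ z, g z ≤ C) ∧
      ∀ z v, |g (z + v) + g (z - v) - 2 * g z| ≤ 2 * C * ‖v‖ ^ 2 := by
  classical
  have hLT : IsClosed (L '' T) := (hT.image L.continuous).isClosed
  have hopen : IsOpenMap L := L.isOpenMap fun z => ⟨s z, hLs z⟩
  have hzero : ∀ w ∈ U, L w ∉ L '' T → f (L w) = 0 := by
    by_contra! hcon
    obtain ⟨w, hwU, hwT, hw0⟩ := hcon
    have hV : IsOpen ((U ∩ (fun w => f (L w)) ⁻¹' {0}ᶜ) ∩ L ⁻¹' (L '' T)ᶜ) :=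
      (hfU.continuousOn.isOpen_inter_preimage hU isOpen_compl_singleton).inter
        (hLT.isOpen_compl.preimage L.continuous)
    have hnull : volume (L '' ((U ∩ (fun w => f (L w)) ⁻¹' {0}ᶜ) ∩ L ⁻¹' (L '' T)ᶜ)) = 0 := by
      refine measure_mono_null ?_ (ae_iff.1 hfT)
      rintro _ ⟨w, ⟨⟨_, h1⟩, h2⟩, rfl⟩ h
      exact h1 (h h2)
    have hemp := ((hopen _ hV).measure_eq_zero_iff volume).1 hnull
    exact Set.eq_empty_iff_forall_notMem.1 hemp _ ⟨w, ⟨⟨hwU, hw0⟩, hwT⟩, rfl⟩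
  set g : (Fin m → ℝ) → ℝ := (L '' T).indicator f with hg
  set G : (Fin n → ℝ) → ℝ := fun w => g (L w) with hG
  have hGU : ∀ w ∈ U, G w = f (L w) := by
    intro w hw
    by_cases h : L w ∈ L '' T
    · simp only [hG, hg, Set.indicator_of_mem h]
    · simp only [hG, hg, Set.indicator_of_notMem h]
      exact (hzero w hw h).symm
  have hGT : ∀ w ∈ T, G =ᶠ[nhds w] fun w => f (L w) := fun w hw =>
    eventually_of_mem (hU.mem_nhds (hTU hw)) hGU
  have hout : ∀ w, L w ∉ L '' T → G =ᶠ[nhds w] fun _ => 0 := fun w hw =>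
    eventually_of_mem ((hLT.isOpen_compl.preimage L.continuous).mem_nhds hw)
      fun w' hw' => Set.indicator_of_notMem hw' _
  have htrans : ∀ w w₀, L w₀ = L w → G = fun w' => G (w' + (w₀ - w)) := by
    intro w w₀ h
    funext w'
    simp only [hG, map_add, map_sub, h, sub_self, add_zero]
  have hloc : ∀ w, ContDiffAt ℝ 2 G w ∧ ‖iteratedFDeriv ℝ 2 G w‖ ≤ C := by
    intro w
    by_cases h : L w ∈ L '' T
    · obtain ⟨w₀, hw₀, hLw⟩ := h
      have hw : w + (w₀ - w) = w₀ := by abel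
      have h1 : ContDiffAt ℝ 2 G w₀ :=
        (hfU.contDiffAt (hU.mem_nhds (hTU hw₀))).congr_of_eventuallyEq (hGT w₀ hw₀)
      rw [htrans w w₀ hLw]
      constructor
      · have h2 : ContDiffAt ℝ 2 G (w + (w₀ - w)) := by rwa [hw]
        exact h2.comp w (contDiffAt_id.add contDiffAt_const)
      · rw [iteratedFDeriv_comp_add_right, hw, ((hGT w₀ hw₀).iteratedFDeriv ℝ 2).eq_of_nhds]
        exact hfC w₀ (hTU hw₀) 2 le_rfl
    · refine ⟨contDiffAt_const.congr_of_eventuallyEq (hout w h), ?_⟩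
      rw [((hout w h).iteratedFDeriv ℝ 2).eq_of_nhds]
      simpa [iteratedFDeriv_fun_zero] using hC
  have hGs : g = fun z => G (s z) := by
    funext z; simp only [hG, hLs]
  have hGcd : ContDiff ℝ 2 G := contDiff_iff_contDiffAt.2 fun w => (hloc w).1
  refine ⟨g, ?_, ?_, ?_, ?_, ?_, ?_⟩
  · rw [hGs]; exact hGcd.continuous.comp s.continuous
  · filter_upwards [hfT] with z hz
    by_cases h : z ∈ L '' T
    · rw [hg, Set.indicator_of_mem h]
    · rw [hg, Set.indicator_of_notMem h, hz h]
  · intro z hz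
    rw [hg, Set.indicator_of_mem hz]
  · exact fun z => Set.indicator_nonneg (fun z _ => hf0 z) z
  · intro z
    by_cases h : z ∈ L '' T
    · rw [hg, Set.indicator_of_mem h]
      obtain ⟨w, hw, rfl⟩ := h
      have := hfC w (hTU hw) 0 (by norm_num)
      rw [norm_iteratedFDeriv_zero] at this
      exact (le_abs_self _).trans this
    · rwa [hg, Set.indicator_of_notMem h]
  · intro z v
    have := abs_second_difference_le hGcd (fun w => (hloc w).2) (s z) (s v)
    rw [← map_add, ← map_sub] at this
    simp only [hG, hLs] at this
    refine this.trans ?_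
    gcongr
    exact hs v

/-! ### The product kernel and the bias -/

lemma KernelRegular.exists_bound {κ : ℝ → ℝ} (hκ : KernelRegular κ) :
    ∃ B : ℝ, 1 ≤ B ∧ (∀ v, κ v ≤ B) ∧ ∀ v w, |κ v - κ w| ≤ B * |v - w| := by
  obtain ⟨C, hC⟩ := hκ.deriv_bounded
  have hC0 : 0 ≤ C := (abs_nonneg _).trans (hC 0)
  have hlip : ∀ v w, |κ v - κ w| ≤ C * |v - w| := fun v w =>
    convex_univ.norm_image_sub_le_of_norm_deriv_le (fun z _ => hκ.differentiable z)
      (fun z _ => hC z) (Set.mem_univ w) (Set.mem_univ v)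
  refine ⟨1 + C, by linarith, fun v => ?_, fun v w => (hlip v w).trans ?_⟩
  · have h1 : ∀ u ∈ Set.Icc v (v + 1), κ v - C ≤ κ u := by
      intro u hu
      have h2 := (abs_le.1 (hlip v u)).2
      have h3 : |v - u| ≤ 1 := abs_le.2 ⟨by linarith [hu.2], by linarith [hu.1]⟩
      nlinarith
    have h2 : ∫ u in Set.Icc v (v + 1), (κ v - C) ≤ ∫ u in Set.Icc v (v + 1), κ u :=
      setIntegral_mono_on (integrableOn_const (by simp)) hκ.integrable.integrableOn
        measurableSet_Icc h1
    have h3 : ∫ u in Set.Icc v (v + 1), κ u ≤ 1 := by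
      rw [← hκ.integral_eq_one]
      exact setIntegral_le_integral hκ.integrable (Eventually.of_forall hκ.nonneg)
    rw [setIntegral_const] at h2
    simp at h2
    linarith
  · have := abs_nonneg (v - w)
    nlinarith

/-- The product kernel `K(x, v) = h^{-m} ∏_q κ((x_q - v_q)/h)` on `ℝᵐ`. -/
noncomputable def prodKernel {m : ℕ} (κ : ℝ → ℝ) (h : ℝ) (v x : Fin m → ℝ) : ℝ :=
  1 / h ^ m * ∏ q, κ ((x q - v q) / h)

lemma measurable_prodKernel {m : ℕ} {κ : ℝ → ℝ} (hκ : Measurable κ) (h : ℝ) (v : Fin m → ℝ) :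
    Measurable (prodKernel κ h v) :=
  (Finset.measurable_prod _ fun q _ =>
    hκ.comp (((measurable_pi_apply q).sub_const _).div_const _)).const_mul _

lemma prodKernel_nonneg {m : ℕ} {κ : ℝ → ℝ} (hκ : ∀ v, 0 ≤ κ v) {h : ℝ} (hh : 0 < h)
    (v x : Fin m → ℝ) : 0 ≤ prodKernel κ h v x :=
  mul_nonneg (by positivity) (Finset.prod_nonneg fun _ _ => hκ _)

lemma prodKernel_le {m Q : ℕ} (hmQ : m ≤ Q) {κ : ℝ → ℝ} (hκ : ∀ v, 0 ≤ κ v) {B : ℝ} (hB1 : 1 ≤ B)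
    (hB : ∀ v, κ v ≤ B) {h : ℝ} (hh : 0 < h) (hh1 : h ≤ 1) (v x : Fin m → ℝ) :
    prodKernel κ h v x ≤ B ^ Q / h ^ Q := by
  have h1 : ∏ q, κ ((x q - v q) / h) ≤ B ^ m := by
    calc ∏ q, κ ((x q - v q) / h) ≤ ∏ _q : Fin m, B :=
          Finset.prod_le_prod (fun _ _ => hκ _) fun _ _ => hB _
      _ = B ^ m := by simp
  calc prodKernel κ h v x ≤ 1 / h ^ m * B ^ m := by
        unfold prodKernel; gcongr
    _ ≤ 1 / h ^ Q * B ^ Q := by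
        gcongr 1 / ?_ * ?_
        · exact pow_le_pow_of_le_one hh.le hh1 hmQ
        · exact pow_le_pow_right₀ hB1 hmQ
    _ = _ := by ring

lemma abs_prod_sub_prod_le {ι : Type*} [DecidableEq ι] (s : Finset ι) {a b : ι → ℝ} {B d : ℝ}
    (hB : 1 ≤ B) (ha : ∀ i, |a i| ≤ B) (hb : ∀ i, |b i| ≤ B) (hd : 0 ≤ d)
    (hab : ∀ i, |a i - b i| ≤ d) :
    |∏ i ∈ s, a i - ∏ i ∈ s, b i| ≤ s.card * (B ^ s.card * d) := by
  induction s using Finset.induction_on with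
  | empty => simp
  | insert x s hx ih =>
    rw [Finset.prod_insert hx, Finset.prod_insert hx, Finset.card_insert_of_notMem hx]
    have hB0 : 0 ≤ B := by linarith
    have e : a x * ∏ i ∈ s, a i - b x * ∏ i ∈ s, b i
        = a x * (∏ i ∈ s, a i - ∏ i ∈ s, b i) + (a x - b x) * ∏ i ∈ s, b i := by ring
    have hpb : |∏ i ∈ s, b i| ≤ B ^ s.card := by
      rw [Finset.abs_prod]
      calc ∏ i ∈ s, |b i| ≤ ∏ _i ∈ s, B :=
            Finset.prod_le_prod (fun _ _ => abs_nonneg _) fun i _ => hb i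
        _ = B ^ s.card := by simp
    rw [e]
    calc |a x * (∏ i ∈ s, a i - ∏ i ∈ s, b i) + (a x - b x) * ∏ i ∈ s, b i|
        ≤ |a x| * |∏ i ∈ s, a i - ∏ i ∈ s, b i| + |a x - b x| * |∏ i ∈ s, b i| := by
          rw [← abs_mul, ← abs_mul]; exact abs_add_le _ _
      _ ≤ B * (s.card * (B ^ s.card * d)) + d * B ^ s.card := by
          gcongr
          · exact ha x
          · exact hab x
      _ ≤ B * (s.card * (B ^ s.card * d)) + d * B ^ (s.card + 1) := by
          gcongr
          · omega
      _ = _ := by push_cast; ring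

lemma abs_prodKernel_sub_le {m Q : ℕ} (hmQ : m ≤ Q) {κ : ℝ → ℝ} (hκ : ∀ v, 0 ≤ κ v) {B : ℝ}
    (hB1 : 1 ≤ B) (hB : ∀ v, κ v ≤ B) (hlip : ∀ v w, |κ v - κ w| ≤ B * |v - w|) {h : ℝ}
    (hh : 0 < h) (hh1 : h ≤ 1) (v v' x : Fin m → ℝ) :
    |prodKernel κ h v x - prodKernel κ h v' x| ≤ Q * B ^ (Q + 1) * ‖v - v'‖ / h ^ (Q + 1) := by
  classical
  have hB0 : 0 ≤ B := by linarith
  have habs : ∀ u, |κ u| ≤ B := fun u => by rw [abs_of_nonneg (hκ u)]; exact hB u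
  have hp := abs_prod_sub_prod_le (Finset.univ : Finset (Fin m))
    (a := fun q => κ ((x q - v q) / h)) (b := fun q => κ ((x q - v' q) / h)) (B := B)
    (d := B * (‖v - v'‖ / h)) hB1 (fun q => habs _) (fun q => habs _) (by positivity) (fun q => by
      refine (hlip _ _).trans ?_
      have e : (x q - v q) / h - (x q - v' q) / h = -((v - v') q / h) := by
        rw [Pi.sub_apply]; ring
      rw [e, abs_neg, abs_div, abs_of_pos hh]
      gcongr
      exact norm_le_pi_norm (v - v') q)
  rw [Finset.card_univ, Fintype.card_fin] at hp
  unfold prodKernel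
  rw [← mul_sub, abs_mul, abs_of_pos (by positivity : 0 < 1 / h ^ m)]
  calc 1 / h ^ m * |∏ q, κ ((x q - v q) / h) - ∏ q, κ ((x q - v' q) / h)|
      ≤ 1 / h ^ m * (m * (B ^ m * (B * (‖v - v'‖ / h)))) := by gcongr
    _ ≤ 1 / h ^ Q * (Q * (B ^ Q * (B * (‖v - v'‖ / h)))) := by
        gcongr 1 / ?_ * (?_ * (?_ * _))
        · exact pow_le_pow_of_le_one hh.le hh1 hmQ
        · exact_mod_cast hmQ
        · exact pow_le_pow_right₀ hB1 hmQ
    _ = _ := by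
        rw [pow_succ h, pow_succ B]; field_simp

lemma integral_prodKernel_mul {m : ℕ} (κ : ℝ → ℝ) {h : ℝ} (hh : 0 < h) (v : Fin m → ℝ)
    (f : (Fin m → ℝ) → ℝ) :
    ∫ x, prodKernel κ h v x * f x = ∫ u : Fin m → ℝ, (∏ q, κ (u q)) * f (v + h • u) := by
  have h1 := integral_add_left_eq_self (μ := (volume : Measure (Fin m → ℝ)))
    (fun x => prodKernel κ h v x * f x) v
  have h2 := Measure.integral_comp_smul (volume : Measure (Fin m → ℝ))
    (fun x => prodKernel κ h v (v + x) * f (v + x)) h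
  rw [← h1, show (∫ x, prodKernel κ h v (v + x) * f (v + x))
    = h ^ m * ∫ x, prodKernel κ h v (v + h • x) * f (v + h • x) from ?_, ← integral_const_mul]
  · refine integral_congr_ae (Eventually.of_forall fun u => ?_)
    have : ∀ q, (h * u q) / h = u q := fun q => by field_simp
    simp only [prodKernel, Pi.add_apply, Pi.smul_apply, smul_eq_mul, add_sub_cancel_left, this]
    have : h ^ m ≠ 0 := by positivity
    field_simp
  · rw [h2, Module.finrank_fin_fun, abs_of_pos (by positivity), smul_eq_mul]
    have : h ^ m ≠ 0 := by positivity
    field_simp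

lemma integrable_prod_kernel {m : ℕ} {κ : ℝ → ℝ} (hκ : KernelRegular κ) :
    Integrable fun u : Fin m → ℝ => ∏ q, κ (u q) :=
  Integrable.fintype_prod (f := fun _ => κ) fun _ => hκ.integrable

lemma integral_prod_kernel {m : ℕ} {κ : ℝ → ℝ} (hκ : KernelRegular κ) :
    ∫ u : Fin m → ℝ, ∏ q, κ (u q) = 1 := by
  rw [integral_fintype_prod_volume_eq_pow, hκ.integral_eq_one, one_pow]

lemma prod_kernel_mul_sq_eq {m : ℕ} (κ : ℝ → ℝ) (q : Fin m) (u : Fin m → ℝ) :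
    (∏ r, κ (u r)) * u q ^ 2 = ∏ r, (if r = q then u r ^ 2 * κ (u r) else κ (u r)) := by
  have : ∀ r, (if r = q then u r ^ 2 * κ (u r) else κ (u r))
      = κ (u r) * (if r = q then u r ^ 2 else 1) := by
    intro r; split_ifs <;> ring
  simp_rw [this, Finset.prod_mul_distrib]
  simp

lemma integrable_prod_kernel_mul_sq {m : ℕ} {κ : ℝ → ℝ} (hκ : KernelRegular κ) (q : Fin m) :
    Integrable fun u : Fin m → ℝ => (∏ r, κ (u r)) * u q ^ 2 := by
  simp_rw [prod_kernel_mul_sq_eq κ q]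
  refine Integrable.fintype_prod (f := fun r x => if r = q then x ^ 2 * κ x else κ x) fun r => ?_
  by_cases h : r = q
  · simpa [h] using hκ.second_moment.1
  · simpa [h] using hκ.integrable

lemma integral_prod_kernel_mul_sq {m : ℕ} {κ : ℝ → ℝ} (hκ : KernelRegular κ) (q : Fin m) :
    ∫ u : Fin m → ℝ, (∏ r, κ (u r)) * u q ^ 2 = ∫ x, x ^ 2 * κ x := by
  simp_rw [prod_kernel_mul_sq_eq κ q]
  rw [integral_fintype_prod_volume_eq_prod (fun r x => if r = q then x ^ 2 * κ x else κ x),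
    Finset.prod_eq_single q]
  · simp
  · intro r _ hr; simp [hr, hκ.integral_eq_one]
  · intro h; exact absurd (Finset.mem_univ q) h

lemma integrable_prod_kernel_mul_bounded {m : ℕ} {κ : ℝ → ℝ} (hκ : KernelRegular κ)
    {f : (Fin m → ℝ) → ℝ} (hf : Continuous f) {C : ℝ} (hfC : ∀ z, |f z| ≤ C) :
    Integrable fun u : Fin m → ℝ => (∏ q, κ (u q)) * f u :=
  (integrable_prod_kernel hκ).mul_bdd (c := C) hf.aestronglyMeasurable
    (Eventually.of_forall hfC)

/-- The mean of the product kernel is bounded by the density. -/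
lemma integral_prodKernel_mul_le {m : ℕ} {κ : ℝ → ℝ} (hκ : KernelRegular κ) {h : ℝ} (hh : 0 < h)
    (v : Fin m → ℝ) {f : (Fin m → ℝ) → ℝ} (hf : Continuous f) (hf0 : ∀ z, 0 ≤ f z) {C : ℝ}
    (hfC : ∀ z, f z ≤ C) :
    ∫ x, prodKernel κ h v x * f x ≤ C := by
  rw [integral_prodKernel_mul κ hh]
  calc ∫ u : Fin m → ℝ, (∏ q, κ (u q)) * f (v + h • u)
      ≤ ∫ u : Fin m → ℝ, (∏ q, κ (u q)) * C := by
        refine integral_mono (integrable_prod_kernel_mul_bounded hκ (by fun_prop) (C := C)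
          fun z => ?_) ((integrable_prod_kernel hκ).mul_const C) fun u => ?_
        · rw [abs_of_nonneg (hf0 _)]; exact hfC _
        · exact mul_le_mul_of_nonneg_left (hfC _) (Finset.prod_nonneg fun _ _ => hκ.nonneg _)
    _ = C := by rw [integral_mul_const, integral_prod_kernel hκ, one_mul]

/-- The bias is of order `h²`: by symmetry of the kernel, the increments of `f` may be replaced by
its second differences. -/
lemma abs_integral_prodKernel_mul_sub_le {m : ℕ} {κ : ℝ → ℝ} (hκ : KernelRegular κ) {h : ℝ}
    (hh : 0 < h) (v : Fin m → ℝ) {f : (Fin m → ℝ) → ℝ} (hf : Continuous f) {C D : ℝ}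
    (hfC : ∀ z, |f z| ≤ C)
    (hfD : ∀ z w, |f (z + w) + f (z - w) - 2 * f z| ≤ D * ‖w‖ ^ 2) (hD : 0 ≤ D) :
    |(∫ x, prodKernel κ h v x * f x) - f v| ≤ D * m * (∫ x, x ^ 2 * κ x) * h ^ 2 := by
  rw [integral_prodKernel_mul κ hh]
  set K : (Fin m → ℝ) → ℝ := fun u => ∏ q, κ (u q) with hK
  have hK0 : ∀ u, 0 ≤ K u := fun u => Finset.prod_nonneg fun _ _ => hκ.nonneg _
  have hi1 : Integrable fun u => K u * f (v + h • u) :=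
    integrable_prod_kernel_mul_bounded hκ (f := fun u => f (v + h • u)) (by fun_prop)
      fun z => hfC _
  have hi2 : Integrable fun u => K u * f (v - h • u) :=
    integrable_prod_kernel_mul_bounded hκ (f := fun u => f (v - h • u)) (by fun_prop)
      fun z => hfC _
  have hi3 : Integrable fun u => K u * (2 * f v) := (integrable_prod_kernel hκ).mul_const _
  have hsymm : ∫ u, K u * f (v - h • u) = ∫ u, K u * f (v + h • u) := by
    rw [← integral_neg_eq_self (fun u => K u * f (v + h • u))]
    refine integral_congr_ae (Eventually.of_forall fun u => ?_)
    have : K (-u) = K u := Finset.prod_congr rfl fun q _ => (hκ.symm (u q)).symm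
    simp only [this, smul_neg, sub_eq_add_neg]
  have hmain : 2 * ((∫ u, K u * f (v + h • u)) - f v)
      = ∫ u, K u * (f (v + h • u) + f (v - h • u) - 2 * f v) := by
    have e : ∀ u, K u * (f (v + h • u) + f (v - h • u) - 2 * f v)
        = K u * f (v + h • u) + K u * f (v - h • u) - K u * (2 * f v) := fun u => by ring
    simp_rw [e]
    have hi12 : Integrable fun u => K u * f (v + h • u) + K u * f (v - h • u) := hi1.add hi2
    rw [integral_sub hi12 hi3, integral_add hi1 hi2, hsymm, integral_mul_const,
      integral_prod_kernel hκ]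
    ring
  have hbound : |∫ u, K u * (f (v + h • u) + f (v - h • u) - 2 * f v)|
      ≤ D * m * (∫ x, x ^ 2 * κ x) * h ^ 2 := by
    calc |∫ u, K u * (f (v + h • u) + f (v - h • u) - 2 * f v)|
        ≤ ∫ u, D * h ^ 2 * ∑ q, K u * u q ^ 2 := by
          rw [← Real.norm_eq_abs]
          refine norm_integral_le_of_norm_le
            ((integrable_finsetSum _ fun q _ => integrable_prod_kernel_mul_sq hκ q).const_mul _)
            (Eventually.of_forall fun u => ?_)
          rw [Real.norm_eq_abs, abs_mul, abs_of_nonneg (hK0 u), ← Finset.mul_sum]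
          have hn : ‖u‖ ^ 2 ≤ ∑ q, u q ^ 2 := by
            have h0 : ‖u‖ ≤ √(∑ q, u q ^ 2) := by
              refine (pi_norm_le_iff_of_nonneg (Real.sqrt_nonneg _)).2 fun q => ?_
              rw [Real.norm_eq_abs, ← Real.sqrt_sq_eq_abs]
              exact Real.sqrt_le_sqrt
                (Finset.single_le_sum (fun q _ => sq_nonneg (u q)) (Finset.mem_univ q))
            calc ‖u‖ ^ 2 ≤ √(∑ q, u q ^ 2) ^ 2 := pow_le_pow_left₀ (norm_nonneg _) h0 2
              _ = _ := Real.sq_sqrt (Finset.sum_nonneg fun q _ => sq_nonneg _)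
          calc K u * |f (v + h • u) + f (v - h • u) - 2 * f v|
              ≤ K u * (D * ‖h • u‖ ^ 2) := mul_le_mul_of_nonneg_left (hfD _ _) (hK0 u)
            _ = K u * (D * (h ^ 2 * ‖u‖ ^ 2)) := by
                rw [norm_smul, Real.norm_of_nonneg hh.le, mul_pow]
            _ ≤ K u * (D * (h ^ 2 * ∑ q, u q ^ 2)) := by
                have := hK0 u
                gcongr
            _ = _ := by ring
      _ = _ := by
          rw [integral_const_mul,
            integral_finsetSum _ fun q _ => integrable_prod_kernel_mul_sq hκ q,
            Finset.sum_congr rfl fun q _ => integral_prod_kernel_mul_sq hκ q]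
          simp only [Finset.sum_const, Finset.card_univ, Fintype.card_fin, nsmul_eq_mul]
          ring
  have h2 : |2 * ((∫ u, K u * f (v + h • u)) - f v)| ≤ D * m * (∫ x, x ^ 2 * κ x) * h ^ 2 := by
    rw [hmain]; exact hbound
  rw [abs_mul, abs_two] at h2
  have := abs_nonneg ((∫ u, K u * f (v + h • u)) - f v)
  linarith

/-! ### Uniform deviations at a fixed sample size -/

/-- The product kernel at `v` applied to the continuous variables `xc w` of an observation `w`,
and set to zero unless `w` lies in the cell `A` of the discrete variables. -/
noncomputable def cellKernel {E : Type*} {m : ℕ} (κ : ℝ → ℝ) (h : ℝ) (xc : E → Fin m → ℝ)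
    (A : Set E) (v : Fin m → ℝ) (w : E) : ℝ :=
  A.indicator (fun w => prodKernel κ h v (xc w)) w

lemma measurable_cellKernel {E : Type*} [MeasurableSpace E] {m : ℕ} {κ : ℝ → ℝ}
    (hκ : Measurable κ) (h : ℝ) {xc : E → Fin m → ℝ} (hxc : Measurable xc) {A : Set E}
    (hA : MeasurableSet A) (v : Fin m → ℝ) : Measurable (cellKernel κ h xc A v) :=
  ((measurable_prodKernel hκ h v).comp hxc).indicator hA

lemma cellKernel_nonneg {E : Type*} {m : ℕ} {κ : ℝ → ℝ} (hκ : ∀ v, 0 ≤ κ v) {h : ℝ} (hh : 0 < h)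
    (xc : E → Fin m → ℝ) (A : Set E) (v : Fin m → ℝ) (w : E) : 0 ≤ cellKernel κ h xc A v w :=
  Set.indicator_nonneg (fun _ _ => prodKernel_nonneg hκ hh _ _) w

lemma cellKernel_le {E : Type*} {m Q : ℕ} (hmQ : m ≤ Q) {κ : ℝ → ℝ} (hκ : ∀ v, 0 ≤ κ v) {B : ℝ}
    (hB1 : 1 ≤ B) (hB : ∀ v, κ v ≤ B) {h : ℝ} (hh : 0 < h) (hh1 : h ≤ 1) (xc : E → Fin m → ℝ)
    (A : Set E) (v : Fin m → ℝ) (w : E) : cellKernel κ h xc A v w ≤ B ^ Q / h ^ Q :=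
  Set.indicator_apply_le' (fun _ => prodKernel_le hmQ hκ hB1 hB hh hh1 _ _) fun _ => by
    have : 0 ≤ B := by linarith
    positivity

lemma abs_cellKernel_sub_le {E : Type*} {m Q : ℕ} (hmQ : m ≤ Q) {κ : ℝ → ℝ} (hκ : ∀ v, 0 ≤ κ v)
    {B : ℝ} (hB1 : 1 ≤ B) (hB : ∀ v, κ v ≤ B) (hlip : ∀ v w, |κ v - κ w| ≤ B * |v - w|) {h : ℝ}
    (hh : 0 < h) (hh1 : h ≤ 1) (xc : E → Fin m → ℝ) (A : Set E) (v v' : Fin m → ℝ) (w : E) :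
    |cellKernel κ h xc A v w - cellKernel κ h xc A v' w|
      ≤ Q * B ^ (Q + 1) * ‖v - v'‖ / h ^ (Q + 1) := by
  by_cases hw : w ∈ A
  · simp only [cellKernel, Set.indicator_of_mem hw]
    exact abs_prodKernel_sub_le hmQ hκ hB1 hB hlip hh hh1 v v' _
  · have : 0 ≤ B := by linarith
    simp only [cellKernel, Set.indicator_of_notMem hw, sub_zero, abs_zero]
    positivity

/-- A ball of radius `R` in `ℝᵐ` has a `δ`-net of at most `((2 R + 3) / δ) ^ Q` points. -/
lemma exists_finite_net {m Q : ℕ} (hmQ : m ≤ Q) {R δ : ℝ} (hR : 0 ≤ R) (hδ : 0 < δ)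
    (hδ1 : δ ≤ 1) :
    ∃ G : Finset (Fin m → ℝ), (G.card : ℝ) ≤ ((2 * R + 3) / δ) ^ Q ∧
      ∀ v : Fin m → ℝ, ‖v‖ ≤ R → ∃ z ∈ G, ‖v - z‖ ≤ δ := by
  classical
  set k : ℤ := ⌈R / δ⌉ with hk
  have hk0 : 0 ≤ k := Int.ceil_nonneg (by positivity)
  refine ⟨(Fintype.piFinset fun _ : Fin m => Finset.Icc (-k) k).image
    fun z q => δ * (z q : ℝ), ?_, ?_⟩
  · have h1 : (((Fintype.piFinset fun _ : Fin m => Finset.Icc (-k) k).image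
        fun z q => δ * (z q : ℝ)).card : ℝ) ≤ (2 * k + 1 : ℝ) ^ m := by
      have h2 := Finset.card_image_le (s := Fintype.piFinset fun _ : Fin m => Finset.Icc (-k) k)
        (f := fun (z : Fin m → ℤ) (q : Fin m) => δ * (z q : ℝ))
      rw [Fintype.card_piFinset, Finset.prod_const, Finset.card_univ, Fintype.card_fin,
        Int.card_Icc] at h2
      have h3 : (((k + 1 - -k).toNat : ℕ) : ℝ) = 2 * k + 1 := by
        rw [show (((k + 1 - -k).toNat : ℕ) : ℝ) = (((k + 1 - -k).toNat : ℤ) : ℝ) by norm_cast,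
          Int.toNat_of_nonneg (by omega)]
        push_cast; ring
      rw [← h3]
      exact_mod_cast h2
    have hkR : (k : ℝ) ≤ R / δ + 1 := (Int.ceil_lt_add_one _).le
    have hkc : (0 : ℝ) ≤ k := by exact_mod_cast hk0
    have h4 : (2 * k + 1 : ℝ) ≤ (2 * R + 3) / δ := by
      have : 3 ≤ 3 / δ := by rw [le_div_iff₀ hδ]; linarith
      calc (2 * k + 1 : ℝ) ≤ 2 * (R / δ + 1) + 1 := by linarith
        _ ≤ 2 * (R / δ) + 3 / δ := by linarith
        _ = _ := by ring
    calc _ ≤ _ := h1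
      _ ≤ ((2 * R + 3) / δ) ^ m := by gcongr
      _ ≤ ((2 * R + 3) / δ) ^ Q := pow_le_pow_right₀ (by linarith) hmQ
  · intro v hv
    refine ⟨fun q => δ * (⌊v q / δ⌋ : ℝ), Finset.mem_image.2 ⟨fun q => ⌊v q / δ⌋, ?_, rfl⟩, ?_⟩
    · rw [Fintype.mem_piFinset]
      intro q
      have hq : |v q| ≤ R := (norm_le_pi_norm v q).trans hv
      rw [Finset.mem_Icc]
      have hle : R / δ ≤ k := Int.le_ceil _
      constructor
      · rw [Int.le_floor, le_div_iff₀ hδ]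
        push_cast
        rw [div_le_iff₀ hδ] at hle
        linarith [(abs_le.1 hq).1]
      · have h1 : ((⌊v q / δ⌋ : ℤ) : ℝ) ≤ k := by
          refine (Int.floor_le _).trans (le_trans ?_ hle)
          gcongr
          exact (abs_le.1 hq).2
        exact_mod_cast h1
    · refine (pi_norm_le_iff_of_nonneg hδ.le).2 fun q => ?_
      rw [Pi.sub_apply, Real.norm_eq_abs]
      have h1 := Int.floor_le (v q / δ)
      have h2 := (Int.lt_floor_add_one (v q / δ)).le
      rw [le_div_iff₀ hδ] at h1
      rw [div_le_iff₀ hδ] at h2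
      rw [abs_le]
      constructor <;> nlinarith

/-- Uniform deviation bound over the ball of radius `R₀`: a union bound over a `δ`-net, the
increments between net points being controlled by the Lipschitz constant of the kernel. -/
lemma measure_exists_deviation_le {Ω E : Type*} [MeasurableSpace Ω] [MeasurableSpace E]
    {μ : Measure Ω} [IsProbabilityMeasure μ] {W : ℕ → Ω → E} (hW : ∀ i, Measurable (W i))
    {m Q : ℕ} (hmQ : m ≤ Q) {κ : ℝ → ℝ} (hκm : Measurable κ) (hκ : ∀ v, 0 ≤ κ v) {B : ℝ}
    (hB1 : 1 ≤ B) (hB : ∀ v, κ v ≤ B) (hlip : ∀ v w, |κ v - κ w| ≤ B * |v - w|) {h : ℝ}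
    (hh : 0 < h) (hh1 : h ≤ 1) {xc : E → Fin m → ℝ} (hxc : Measurable xc) {A : Set E}
    (hA : MeasurableSet A) {c : ℝ} (hc : ∀ i v, ∫ ω, cellKernel κ h xc A v (W i ω) ∂μ ≤ c)
    {J : ℕ → Finset ℕ} {q N : ℕ} {a : ℕ → ℝ} (hN : 0 < N)
    (hJ : ∀ g : ℕ → ℝ, ∑ i ∈ Finset.range N, g i = ∑ k ∈ Finset.range q, ∑ i ∈ J k, g i)
    (ha0 : ∀ k, 0 ≤ a k)
    (ha : ∀ k < q, ∀ A B : Set Ω,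
      MeasurableSet[sigmaGen W ((Finset.range (k - 1)).biUnion J)] A →
      MeasurableSet[sigmaGen W (J k)] B → |μ.real (A ∩ B) - μ.real A * μ.real B| ≤ a k)
    {R V lam ξ : ℝ} (hR : ∀ k < q, ((J k).card : ℝ) ≤ R)
    (hV : ∑ k ∈ Finset.range q, ((J k).card : ℝ) ^ 2 ≤ V) (hlam : 0 < lam) (hξ : 0 < ξ)
    (hlamR : lam * (R * (B ^ Q / h ^ Q)) ≤ 1) (t : ℝ)
    {R₀ δ : ℝ} (hR₀ : 0 ≤ R₀) (hδ : 0 < δ) (hδ1 : δ ≤ 1) :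
    μ {ω | ∃ v, ‖v‖ ≤ R₀ ∧
        (2 * (t / lam) + q * ξ) / N + 2 * (Q * B ^ (Q + 1) * δ / h ^ (Q + 1))
        < |1 / (N : ℝ) * ∑ i ∈ Finset.range N, (cellKernel κ h xc A v (W i ω)
            - ∫ ω, cellKernel κ h xc A v (W i ω) ∂μ)|}
      ≤ ENNReal.ofReal (((2 * R₀ + 3) / δ) ^ Q * (4 *
        (Real.exp (-t + lam ^ 2 * (B ^ Q / h ^ Q * c) * V)
        + 8 * √(R * (B ^ Q / h ^ Q) / ξ + 1) * ∑ k ∈ Finset.range q, a k))) := by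
  classical
  obtain ⟨G, hGcard, hG⟩ := exists_finite_net hmQ hR₀ hδ hδ1
  set φ : (Fin m → ℝ) → E → ℝ := cellKernel κ h xc A with hφ
  have hφm : ∀ v, Measurable (φ v) := fun v => measurable_cellKernel hκm h hxc hA v
  have hφ0 : ∀ v w, 0 ≤ φ v w := fun v w => cellKernel_nonneg hκ hh xc A v w
  have hφb : ∀ v w, φ v w ≤ B ^ Q / h ^ Q := fun v w =>
    cellKernel_le hmQ hκ hB1 hB hh hh1 xc A v w
  have hφi : ∀ v i, Integrable (fun ω => φ v (W i ω)) μ := fun v i =>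
    integrable_of_measurable_of_abs_le (b := B ^ Q / h ^ Q) ((hφm v).comp (hW i)) fun ω => by
      rw [abs_of_nonneg (hφ0 _ _)]; exact hφb _ _
  set Bd := 4 * (Real.exp (-t + lam ^ 2 * (B ^ Q / h ^ Q * c) * V)
        + 8 * √(R * (B ^ Q / h ^ Q) / ξ + 1) * ∑ k ∈ Finset.range q, a k) with hBd
  have hBd0 : 0 ≤ Bd := by
    have : 0 ≤ ∑ k ∈ Finset.range q, a k := Finset.sum_nonneg fun k _ => ha0 k
    positivity
  have hNpos : (0 : ℝ) < N := by exact_mod_cast hN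
  set Λ := Q * B ^ (Q + 1) * δ / h ^ (Q + 1) with hΛ
  set dev : (Fin m → ℝ) → Ω → ℝ := fun v ω =>
    ∑ i ∈ Finset.range N, (φ v (W i ω) - ∫ ω, φ v (W i ω) ∂μ) with hdev
  have hpt : ∀ v, μ {ω | 2 * (t / lam) + q * ξ ≤ |dev v ω|} ≤ ENNReal.ofReal Bd := by
    intro v
    have := measureReal_abs_block_sum_ge_le hW (hφm v) (hφ0 v) (hφb v) (fun i => hc i v) ha0 ha
      hR hV hlam hξ hlamR t
    simp only [← hJ fun i => φ v (W i _) - ∫ ω, φ v (W i ω) ∂μ] at this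
    rw [← ENNReal.ofReal_toReal (measure_ne_top μ _)]
    exact ENNReal.ofReal_le_ofReal this
  have hsub : {ω | ∃ v, ‖v‖ ≤ R₀ ∧
        (2 * (t / lam) + q * ξ) / N + 2 * Λ < |1 / (N : ℝ) * dev v ω|}
      ⊆ ⋃ z ∈ G, {ω | 2 * (t / lam) + q * ξ ≤ |dev z ω|} := by
    -- `Λ` bounds the increment of the estimator, and again that of its mean, hence the term `2 * Λ`
    rintro ω ⟨v, hv, hlt⟩
    obtain ⟨z, hzG, hvz⟩ := hG v hv
    rw [Set.mem_iUnion₂]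
    refine ⟨z, hzG, ?_⟩
    by_contra hcon
    have hcon' : |dev z ω| < 2 * (t / lam) + q * ξ := not_le.1 hcon
    have hB0 : 0 ≤ B := by linarith
    have hinc : ∀ w, |φ v w - φ z w| ≤ Λ := fun w =>
      (abs_cellKernel_sub_le hmQ hκ hB1 hB hlip hh hh1 xc A v z w).trans (by
        rw [hΛ]; gcongr)
    have hincE : ∀ i, |∫ ω, φ v (W i ω) ∂μ - ∫ ω, φ z (W i ω) ∂μ| ≤ Λ := by
      intro i
      rw [← integral_sub (hφi v i) (hφi z i)]
      have := norm_integral_le_of_norm_le_const (μ := μ) (C := Λ)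
        (f := fun ω => φ v (W i ω) - φ z (W i ω)) (Eventually.of_forall fun ω => hinc _)
      simpa using this
    have hd : |dev v ω - dev z ω| ≤ N * (2 * Λ) := by
      rw [hdev]
      dsimp only
      rw [← Finset.sum_sub_distrib]
      refine (Finset.abs_sum_le_sum_abs _ _).trans ?_
      have : ∀ i ∈ Finset.range N, |φ v (W i ω) - ∫ ω, φ v (W i ω) ∂μ
          - (φ z (W i ω) - ∫ ω, φ z (W i ω) ∂μ)| ≤ 2 * Λ := by
        intro i _
        have h1 := abs_le.1 (hinc (W i ω))
        have h2 := abs_le.1 (hincE i)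
        rw [abs_le]
        constructor <;> linarith [h1.1, h1.2, h2.1, h2.2]
      have := Finset.sum_le_card_nsmul _ _ _ this
      simpa using this
    rw [abs_mul, abs_of_pos (by positivity : 0 < 1 / (N : ℝ))] at hlt
    have h3 : |dev v ω| < 2 * (t / lam) + q * ξ + N * (2 * Λ) := by
      have := abs_sub_abs_le_abs_sub (dev v ω) (dev z ω)
      linarith
    have h4 : 1 / (N : ℝ) * |dev v ω| < (2 * (t / lam) + q * ξ) / N + 2 * Λ := by
      calc 1 / (N : ℝ) * |dev v ω| < 1 / (N : ℝ) * (2 * (t / lam) + q * ξ + N * (2 * Λ)) := by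
            gcongr
        _ = _ := by field_simp
    linarith
  refine (measure_mono hsub).trans ((measure_biUnion_finset_le _ _).trans ?_)
  calc ∑ z ∈ G, μ {ω | 2 * (t / lam) + q * ξ ≤ |dev z ω|}
      ≤ ∑ z ∈ G, ENNReal.ofReal Bd := Finset.sum_le_sum fun z _ => hpt z
    _ = ENNReal.ofReal (G.card * Bd) := by
        rw [Finset.sum_const, nsmul_eq_mul, ENNReal.ofReal_mul (Nat.cast_nonneg _),
          ENNReal.ofReal_natCast]
    _ ≤ _ := ENNReal.ofReal_le_ofReal (by gcongr)

/-! ### Rate of the uniform deviations -/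

/-- With the net width `δ = h ^ (Q + 1) ε`, where `ε² = ln N / (N h ^ Q)`, the number `δ ^ (-Q)` is
exactly the factor `L_N` in the mixing condition. -/
lemma one_div_netWidth_pow {Q : ℕ} {N h L ε : ℝ} (hN : 0 < N) (hh : 0 < h) (hL : 0 < L)
    (hε : 0 < ε) (hε2 : ε ^ 2 = L / (N * h ^ Q)) :
    (1 / (h ^ (Q + 1) * ε)) ^ Q = (N / (L * h ^ (Q + 2))) ^ ((Q : ℝ) / 2) := by
  have h1 : N / (L * h ^ (Q + 2)) = (1 / (h ^ (Q + 1) * ε)) ^ 2 := by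
    rw [div_pow, mul_pow, hε2, one_pow]
    field_simp
    ring
  have h0 : 0 ≤ 1 / (h ^ (Q + 1) * ε) := by positivity
  rw [h1, ← Real.rpow_natCast (1 / (h ^ (Q + 1) * ε)) 2, ← Real.rpow_mul h0, ← Real.rpow_natCast]
  congr 1
  push_cast
  ring

lemma one_div_netWidth_pow_le {Q : ℕ} {N h L ε : ℝ} (hN : 1 ≤ N) (hh : 0 < h) (hh1 : h ≤ 1)
    (hQ : 1 ≤ Q) (hNh : 1 ≤ N * h ^ Q) (hL : 1 ≤ L) (hε : 0 < ε) (hε1 : ε ≤ 1)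
    (hε2 : ε ^ 2 = L / (N * h ^ Q)) :
    (1 / (h ^ (Q + 1) * ε)) ^ Q ≤ N ^ ((Q + 2) * Q) := by
  have hN0 : 0 < N := by linarith
  have hhN : 1 / N ≤ h := by
    have h1 : h ^ Q ≤ h := by
      calc h ^ Q ≤ h ^ 1 := pow_le_pow_of_le_one hh.le hh1 hQ
        _ = h := pow_one h
    rw [div_le_iff₀ hN0]
    nlinarith
  have hεN : 1 / N ≤ ε := by
    have h1 : h ^ Q ≤ 1 := pow_le_one₀ hh.le hh1
    have h2 : 1 / N ≤ ε ^ 2 := by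
      rw [hε2, div_le_div_iff₀ hN0 (by positivity)]
      nlinarith
    nlinarith
  have hδ : 1 / N ^ (Q + 2) ≤ h ^ (Q + 1) * ε := by
    calc 1 / N ^ (Q + 2) = (1 / N) ^ (Q + 1) * (1 / N) := by
          rw [← pow_succ, one_div_pow]
      _ ≤ h ^ (Q + 1) * ε := by gcongr
  rw [pow_mul]
  gcongr
  rw [div_le_iff₀ (by positivity)]
  rw [div_le_iff₀ (by positivity)] at hδ
  linarith

/-- The centred kernel estimator of one cell is uniformly of order `(ln N / (N h ^ Q)) ^ (1/2)`. -/
lemma exists_tendsto_measure_deviation {Ω E : Type*} [MeasurableSpace Ω] [MeasurableSpace E]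
    {μ : Measure Ω} [IsProbabilityMeasure μ] {W : ℕ → Ω → E} (hW : ∀ i, Measurable (W i))
    {m Q : ℕ} (hmQ : m ≤ Q) (hQ : 1 ≤ Q) {κ : ℝ → ℝ} (hκ : KernelRegular κ) {h : ℕ → ℝ}
    (hh : BandwidthRegular Q h) {Δ : ℕ → ℕ → Finset ℕ} (hΔ : NeighbourhoodsRegular Q h Δ)
    {M : ℕ} {q : ℕ → ℕ} {I : ℕ → ℕ → Finset ℕ}
    (hpart : ∀ N, 1 ≤ N → IsGreedyPartition N (Δ N) M (q N) (I N))
    (hα : Tendsto (fun N : ℕ => mixingPsi Q (h N) N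
      (∑ k ∈ Finset.range (q N), blockDependence μ W (Δ N) (I N) k)) atTop (nhds 0))
    {xc : E → Fin m → ℝ} (hxc : Measurable xc) {A : Set E} (hA : MeasurableSet A) {c : ℝ}
    (hc0 : 0 ≤ c) (hc : ∀ N i v, ∫ ω, cellKernel κ (h N) xc A v (W i ω) ∂μ ≤ c)
    {R₀ : ℝ} (hR₀ : 0 ≤ R₀) :
    ∃ A₀ : ℝ, 0 < A₀ ∧ Tendsto (fun N : ℕ => μ {ω | ∃ v, ‖v‖ ≤ R₀ ∧
        A₀ * (Real.log N / ((N : ℝ) * h N ^ Q)) ^ (1 / 2 : ℝ)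
        < |1 / (N : ℝ) * ∑ i ∈ Finset.range N, (cellKernel κ (h N) xc A v (W i ω)
            - ∫ ω, cellKernel κ (h N) xc A v (W i ω) ∂μ)|}) atTop (nhds 0) := by
  obtain ⟨B, hB1, hB, hlip⟩ := hκ.exists_bound
  have hB0 : 0 < B := by linarith
  obtain ⟨C₁, hC₁, hmax⟩ := hΔ.max_card.exists_pos
  obtain ⟨C₂, hC₂, hsq⟩ := hΔ.sum_card_sq.exists_pos
  rw [isBigOWith_iff] at hmax hsq
  -- `C₃⁻¹` scales the exponential parameter `lam = ln N / (C₃ N ε)` so that `lam` times a block sum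
  -- is at most `1`; `C₄ ln N` is then the variance term, and `N ^ (K - 1)` bounds the size of the net
  set C₃ : ℝ := M * C₁ * B ^ Q + 1 with hC₃
  have hC₃pos : 0 < C₃ := by positivity
  set C₄ : ℝ := (1 / C₃) ^ 2 * (B ^ Q * c * (M * C₂)) with hC₄
  have hC₄0 : 0 ≤ C₄ := by positivity
  set K : ℕ := (Q + 2) * Q + 1 with hK
  set A₀ : ℝ := 2 * ((C₄ + K) * C₃) + 1 + 2 * (Q * B ^ (Q + 1)) with hA₀
  refine ⟨A₀, by positivity, ?_⟩
  set Ψ : ℕ → ℝ := fun N => mixingPsi Q (h N) N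
      (∑ k ∈ Finset.range (q N), blockDependence μ W (Δ N) (I N) k) with hΨ
  set u : ℕ → ℝ := fun N => (2 * R₀ + 3) ^ Q * (4 * (1 / (N : ℝ) + 8 * √C₃ * Ψ N)) with hu
  have hu0 : Tendsto (fun N => ENNReal.ofReal (u N)) atTop (nhds 0) := by
    have h1 : Tendsto u atTop (nhds ((2 * R₀ + 3) ^ Q * (4 * (0 + 8 * √C₃ * 0)))) :=
      ((tendsto_one_div_atTop_nhds_zero_nat.add (hα.const_mul _)).const_mul _).const_mul _
    have h2 := ENNReal.tendsto_ofReal h1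
    simpa using h2
  refine tendsto_of_tendsto_of_tendsto_of_le_of_le' tendsto_const_nhds hu0
    (Eventually.of_forall fun _ => zero_le) ?_
  filter_upwards [hmax, hsq, eventually_ge_atTop 3, hh.tendsto_atTop.eventually_ge_atTop 1,
    hh.tendsto_zero.eventually_le_const (show (0 : ℝ) < 1 by norm_num),
    hh.log_tendsto_zero.eventually_le_const (show (0 : ℝ) < 1 by norm_num)]
    with N hmaxN hsqN hN3 hNh hh1 hlog
  have hN1 : 1 ≤ N := by omega
  have hN0 : 0 < N := by omega
  have hNpos : (0 : ℝ) < N := by exact_mod_cast hN0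
  have hN1' : (1 : ℝ) ≤ N := by exact_mod_cast hN1
  have hhpos := hh.pos N
  set L := Real.log N with hLdef
  have hL1 : 1 ≤ L := by
    rw [hLdef, Real.le_log_iff_exp_le hNpos]
    have : (3 : ℝ) ≤ N := by exact_mod_cast hN3
    linarith [Real.exp_one_lt_d9]
  have hLpos : 0 < L := by linarith
  have hLN : L ≤ N := by
    have := Real.log_le_sub_one_of_pos hNpos
    linarith
  set ε := (L / ((N : ℝ) * h N ^ Q)) ^ (1 / 2 : ℝ) with hεdef
  have hratio : 0 < L / ((N : ℝ) * h N ^ Q) := by positivity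
  have hε : 0 < ε := Real.rpow_pos_of_pos hratio _
  have hε2 : ε ^ 2 = L / ((N : ℝ) * h N ^ Q) := by
    rw [hεdef, ← Real.sqrt_eq_rpow, Real.sq_sqrt hratio.le]
  have hε1 : ε ≤ 1 := by
    rw [hεdef]
    exact Real.rpow_le_one hratio.le hlog (by norm_num)
  have hkey : (N : ℝ) * h N ^ Q * ε ^ 2 = L := by
    rw [hε2]; field_simp
  have hgp := hpart N hN1
  have hself := hΔ.self_mem N
  have hqN : (q N : ℝ) ≤ N := by exact_mod_cast hgp.number_of_blocks_le hN1 hself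
  set rbar : ℝ := (((Finset.range N).sup fun i => (Δ N i).card : ℕ) : ℝ) with hrbar
  have hrε : rbar * ε ≤ C₁ := by
    have h1 := (le_abs_self _).trans hmaxN
    simpa using h1
  have hR : ∀ k < q N, ((blockAt (Δ N) (I N) k).card : ℝ) ≤ M * C₁ / ε := by
    intro k hk
    refine (hgp.card_blockAt_le hN1 hk).trans ?_
    rw [mul_div_assoc]
    gcongr
    rwa [le_div_iff₀ hε]
  have hV : ∑ k ∈ Finset.range (q N), ((blockAt (Δ N) (I N) k).card : ℝ) ^ 2
      ≤ M * (C₂ * N) := by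
    refine (hgp.sum_card_blockAt_sq_le hN1 hself).trans ?_
    gcongr
    have h1 := (le_abs_self _).trans hsqN
    rw [norm_one, mul_one, one_div, inv_mul_le_iff₀ hNpos] at h1
    linarith
  -- the neighbourhood sizes are `O(1 / ε)`, so `lam` times a block sum is
  -- `O(ln N / (N h ^ Q ε ^ 2)) = O(1)`
  set lam : ℝ := 1 / C₃ * L / (N * ε) with hlamdef
  have hlam : 0 < lam := by positivity
  have hb : lam * (M * C₁ / ε * (B ^ Q / h N ^ Q)) = M * C₁ * B ^ Q / C₃ := by
    have : lam * (M * C₁ / ε * (B ^ Q / h N ^ Q))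
        = M * C₁ * B ^ Q / C₃ * (L / (N * h N ^ Q * ε ^ 2)) := by
      rw [hlamdef]; field_simp
    rw [this, hkey, div_self hLpos.ne', mul_one]
  have hlamR : lam * (M * C₁ / ε * (B ^ Q / h N ^ Q)) ≤ 1 := by
    rw [hb, div_le_one hC₃pos, hC₃]; linarith
  have hexp : lam ^ 2 * (B ^ Q / h N ^ Q * c) * (M * (C₂ * N)) = C₄ * L := by
    have : lam ^ 2 * (B ^ Q / h N ^ Q * c) * (M * (C₂ * N))
        = C₄ * L * (L / (N * h N ^ Q * ε ^ 2)) := by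
      rw [hlamdef, hC₄]; field_simp
    rw [this, hkey, div_self hLpos.ne', mul_one]
  have hnval : M * C₁ / ε * (B ^ Q / h N ^ Q) / ε + 1 ≤ C₃ * (N / L) := by
    have h1 : M * C₁ / ε * (B ^ Q / h N ^ Q) / ε
        = M * C₁ * B ^ Q * (N / (N * h N ^ Q * ε ^ 2)) := by
      field_simp
    have h2 : 1 ≤ N / L := by rwa [le_div_iff₀ hLpos, one_mul]
    rw [h1, hkey, hC₃]
    linarith
  set δ : ℝ := h N ^ (Q + 1) * ε with hδdef
  have hδ : 0 < δ := by positivity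
  have hδ1 : δ ≤ 1 := mul_le_one₀ (pow_le_one₀ hhpos.le hh1) hε.le hε1
  have hmain := measure_exists_deviation_le (μ := μ) hW hmQ hκ.differentiable.continuous.measurable
    hκ.nonneg hB1 hB hlip hhpos hh1 hxc hA (hc N) hN0 hgp.sum_range_eq
    (fun k => blockDependence_nonneg μ W (Δ N) (I N) k)
    (fun k _ A B hA hB => abs_sub_le_strongMixingCoeff _ _ μ hA hB)
    hR hV hlam hε hlamR ((C₄ + K) * L) hR₀ hδ hδ1
  refine (measure_mono ?_).trans (hmain.trans (ENNReal.ofReal_le_ofReal ?_))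
  · rintro ω ⟨v, hv, hlt⟩
    refine ⟨v, hv, lt_of_le_of_lt ?_ hlt⟩
    have e1 : (C₄ + K) * L / lam = (C₄ + K) * C₃ * (N * ε) := by
      rw [hlamdef]; field_simp
    have e2 : (Q : ℝ) * B ^ (Q + 1) * δ / h N ^ (Q + 1) = Q * B ^ (Q + 1) * ε := by
      rw [hδdef]; field_simp
    rw [e1, e2]
    calc (2 * ((C₄ + K) * C₃ * (N * ε)) + q N * ε) / N + 2 * (Q * B ^ (Q + 1) * ε)
        ≤ (2 * ((C₄ + K) * C₃ * (N * ε)) + N * ε) / N + 2 * (Q * B ^ (Q + 1) * ε) := by gcongr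
      _ = A₀ * ε := by rw [hA₀]; field_simp
  · set Sα := ∑ k ∈ Finset.range (q N), blockDependence μ W (Δ N) (I N) k with hSα
    have hSα0 : 0 ≤ Sα := Finset.sum_nonneg fun k _ => blockDependence_nonneg μ W _ _ k
    have hexpK : Real.exp (-((C₄ + K) * L) + C₄ * L) = 1 / (N : ℝ) ^ K := by
      rw [show -((C₄ + K) * L) + C₄ * L = -(K * L) by ring, Real.exp_neg, mul_comm, hLdef,
        Real.exp_mul, Real.exp_log hNpos, Real.rpow_natCast, one_div]
    have hnet := one_div_netWidth_pow_le hN1' hhpos hh1 hQ hNh hL1 hε hε1 hε2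
    have hnet' := one_div_netWidth_pow hNpos hhpos hLpos hε hε2
    rw [hexp, hexpK]
    have hfirst : (1 / δ) ^ Q * (1 / (N : ℝ) ^ K) ≤ 1 / N := by
      calc (1 / δ) ^ Q * (1 / (N : ℝ) ^ K) ≤ (N : ℝ) ^ ((Q + 2) * Q) * (1 / (N : ℝ) ^ K) := by
            gcongr
        _ = 1 / N := by
            rw [hK, pow_succ]; field_simp
    have hsecond : (1 / δ) ^ Q * (√(M * C₁ / ε * (B ^ Q / h N ^ Q) / ε + 1) * Sα)
        ≤ √C₃ * Ψ N := by
      have hs : √(M * C₁ / ε * (B ^ Q / h N ^ Q) / ε + 1) ≤ √C₃ * (N / L) ^ (1 / 2 : ℝ) := by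
        rw [← Real.sqrt_eq_rpow, ← Real.sqrt_mul hC₃pos.le]
        exact Real.sqrt_le_sqrt hnval
      calc (1 / δ) ^ Q * (√(M * C₁ / ε * (B ^ Q / h N ^ Q) / ε + 1) * Sα)
          ≤ (1 / δ) ^ Q * (√C₃ * (N / L) ^ (1 / 2 : ℝ) * Sα) := by gcongr
        _ = √C₃ * Ψ N := by
            rw [hΨ, hδdef, hnet']
            simp only [mixingPsi]
            ring
    calc ((2 * R₀ + 3) / δ) ^ Q * (4 * (1 / (N : ℝ) ^ K
          + 8 * √(M * C₁ / ε * (B ^ Q / h N ^ Q) / ε + 1) * Sα))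
        = (2 * R₀ + 3) ^ Q * (4 * ((1 / δ) ^ Q * (1 / (N : ℝ) ^ K)
          + 8 * ((1 / δ) ^ Q * (√(M * C₁ / ε * (B ^ Q / h N ^ Q) / ε + 1) * Sα)))) := by
          rw [div_eq_mul_one_div (2 * R₀ + 3) δ, mul_pow]; ring
      _ ≤ (2 * R₀ + 3) ^ Q * (4 * (1 / N + 8 * (√C₃ * Ψ N))) := by gcongr
      _ = u N := by rw [hu]; ring

/-! ### The five components of the estimator -/

lemma ae_mem_lawSupport {Ω E : Type*} [MeasurableSpace Ω] [MeasurableSpace E] [TopologicalSpace E]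
    [HereditarilyLindelofSpace E] (μ : Measure Ω) {X : ℕ → Ω → E} (hX : ∀ i, Measurable (X i))
    (i : ℕ) : ∀ᵐ ω ∂μ, X i ω ∈ lawSupport μ X := by
  have h1 : ∀ᵐ x ∂(μ.map (X i)), x ∈ (μ.map (X i)).support := Measure.support_mem_ae
  filter_upwards [ae_of_ae_map (hX i).aemeasurable h1] with ω hω
  exact Set.mem_iUnion.2 ⟨i, hω⟩

lemma integral_cellKernel {Ω E : Type*} [MeasurableSpace Ω] [MeasurableSpace E] {μ : Measure Ω}
    {w : Ω → E} (hw : Measurable w) {m : ℕ} {κ : ℝ → ℝ} (hκ : Measurable κ) (h : ℝ)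
    {xc : E → Fin m → ℝ} (hxc : Measurable xc) {A : Set E} (hA : MeasurableSet A)
    {f : (Fin m → ℝ) → ℝ} (hf0 : ∀ z, 0 ≤ f z) (hfm : Measurable f)
    (hf : (μ.restrict {ω | w ω ∈ A}).map (fun ω => xc (w ω))
      = (volume : Measure (Fin m → ℝ)).withDensity fun z => ENNReal.ofReal (f z))
    (v : Fin m → ℝ) :
    ∫ ω, cellKernel κ h xc A v (w ω) ∂μ = ∫ x, prodKernel κ h v x * f x := by
  have e : ∀ ω, cellKernel κ h xc A v (w ω)
      = {ω | w ω ∈ A}.indicator (fun ω => prodKernel κ h v (xc (w ω))) ω := fun ω => by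
    by_cases hωA : w ω ∈ A
    · simp [cellKernel, hωA]
    · simp [cellKernel, hωA]
  simp_rw [e]
  have hwA : MeasurableSet {ω | w ω ∈ A} := hw hA
  have hxw : Measurable fun ω => xc (w ω) := hxc.comp hw
  rw [integral_indicator hwA, ← integral_map hxw.aemeasurable (f := prodKernel κ h v)
      (measurable_prodKernel hκ h v).aestronglyMeasurable]
  rw [hf, integral_withDensity_eq_integral_toReal_smul hfm.ennreal_ofReal
    (Eventually.of_forall fun _ => ENNReal.ofReal_lt_top)]
  refine integral_congr_ae (Eventually.of_forall fun x => ?_)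
  simp only [ENNReal.toReal_ofReal (hf0 x), smul_eq_mul]
  ring

/-- Uniform rate for one cell of one of the density estimators, uniformly over the image `L '' T`
of the support `T` of the continuous observables under the projection `L` that selects the
continuous variables in question. -/
lemma exists_tendsto_measure_cell {Ω E : Type*} [MeasurableSpace Ω] [MeasurableSpace E]
    {μ : Measure Ω} [IsProbabilityMeasure μ] {W : ℕ → Ω → E} (hW : ∀ i, Measurable (W i))
    {n m Q : ℕ} (hmQ : m ≤ Q) (hQ : 1 ≤ Q) {κ : ℝ → ℝ} (hκ : KernelRegular κ) {h : ℕ → ℝ}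
    (hh : BandwidthRegular Q h) {Δ : ℕ → ℕ → Finset ℕ} (hΔ : NeighbourhoodsRegular Q h Δ)
    {M : ℕ} {q : ℕ → ℕ} {I : ℕ → ℕ → Finset ℕ}
    (hpart : ∀ N, 1 ≤ N → IsGreedyPartition N (Δ N) M (q N) (I N))
    (hα : Tendsto (fun N : ℕ => mixingPsi Q (h N) N
      (∑ k ∈ Finset.range (q N), blockDependence μ W (Δ N) (I N) k)) atTop (nhds 0))
    (L : (Fin n → ℝ) →L[ℝ] (Fin m → ℝ)) (s : (Fin m → ℝ) →L[ℝ] (Fin n → ℝ))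
    (hLs : ∀ z, L (s z) = z) (hs : ∀ z, ‖s z‖ ≤ ‖z‖) {T U : Set (Fin n → ℝ)} (hT : IsCompact T)
    (hU : IsOpen U) (hTU : T ⊆ U) {wc : E → Fin n → ℝ} (hwc : Measurable wc)
    (hWT : ∀ i, ∀ᵐ ω ∂μ, wc (W i ω) ∈ T) {A : Set E} (hA : MeasurableSet A)
    {f : (Fin m → ℝ) → ℝ} (hf0 : ∀ z, 0 ≤ f z) (hfm : Measurable f)
    (hf : ∀ i, (μ.restrict {ω | W i ω ∈ A}).map (fun ω => L (wc (W i ω)))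
      = (volume : Measure (Fin m → ℝ)).withDensity fun z => ENNReal.ofReal (f z))
    {C : ℝ} (hfU : ContDiffOn ℝ 2 (fun w => f (L w)) U)
    (hfC : ∀ w ∈ U, ∀ k : ℕ, k ≤ 2 → ‖iteratedFDeriv ℝ k (fun w => f (L w)) w‖ ≤ C) :
    ∃ A₀ : ℝ, 0 < A₀ ∧ Tendsto (fun N : ℕ => μ {ω | ∃ v ∈ L '' T,
        A₀ * ((Real.log N / ((N : ℝ) * h N ^ Q)) ^ (1 / 2 : ℝ) + h N ^ 2)
        < |1 / (N : ℝ) * (∑ i ∈ Finset.range N, cellKernel κ (h N) (fun w => L (wc w)) A v (W i ω))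
            - f v|}) atTop (nhds 0) := by
  have hxc : Measurable fun w => L (wc w) := L.continuous.measurable.comp hwc
  have hC0 : (0 : ℝ) ≤ max C 0 := le_max_right _ _
  have hfT : ∀ᵐ z, z ∉ L '' T → f z = 0 := by
    have hTm : MeasurableSet (L '' T)ᶜ := (hT.image L.continuous).measurableSet.compl
    have h0 : (volume : Measure (Fin m → ℝ)).withDensity (fun z => ENNReal.ofReal (f z))
        (L '' T)ᶜ = 0 := by
      have hL0 : Measurable fun ω => L (wc (W 0 ω)) := hxc.comp (hW 0)
      rw [← hf 0, Measure.map_apply hL0 hTm]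
      refine le_antisymm ((Measure.restrict_apply_le _ _).trans ?_) zero_le
      refine (measure_mono_null ?_ (ae_iff.1 (hWT 0))).le
      exact fun ω hω hmem => hω ⟨_, hmem, rfl⟩
    rw [withDensity_apply _ hTm, lintegral_eq_zero_iff hfm.ennreal_ofReal,
      EventuallyEq, ae_restrict_iff' hTm] at h0
    filter_upwards [h0] with z hz hzT
    exact le_antisymm (ENNReal.ofReal_eq_zero.1 (hz hzT)) (hf0 z)
  obtain ⟨g, hgc, hfg, hgT, hg0, hgC, hgD⟩ := exists_extension_bounded_second_difference L s hLs hs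
    hT hU hTU hf0 hfT hC0 hfU fun w hw k hk => (hfC w hw k hk).trans (le_max_left _ _)
  have hmean : ∀ N i v, ∫ ω, cellKernel κ (h N) (fun w => L (wc w)) A v (W i ω) ∂μ
      = ∫ x, prodKernel κ (h N) v x * g x := by
    intro N i v
    rw [integral_cellKernel (hW i) hκ.differentiable.continuous.measurable (h N) hxc hA hf0 hfm
      (hf i) v]
    refine integral_congr_ae ?_
    filter_upwards [hfg] with x hx
    rw [hx]
  obtain ⟨R₀, hR₀pos, hR₀⟩ := (hT.image L.continuous).isBounded.exists_pos_norm_le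
  obtain ⟨A₁, hA₁, hlim⟩ := exists_tendsto_measure_deviation hW hmQ hQ hκ hh hΔ hpart hα hxc hA
    hC0 (fun N i v => by
      rw [hmean]
      exact integral_prodKernel_mul_le hκ (hh.pos N) v hgc hg0 hgC) hR₀pos.le
  set D : ℝ := 2 * max C 0 * m * ∫ x, x ^ 2 * κ x with hD
  have hD0 : 0 ≤ D := mul_nonneg (by positivity) hκ.second_moment.2.le
  refine ⟨A₁ + D, by positivity, ?_⟩
  refine tendsto_of_tendsto_of_tendsto_of_le_of_le' tendsto_const_nhds hlim
    (Eventually.of_forall fun _ => zero_le) ?_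
  filter_upwards [eventually_ge_atTop 1] with N hN
  refine measure_mono ?_
  rintro ω ⟨v, hv, hlt⟩
  refine ⟨v, hR₀ v hv, ?_⟩
  have hNpos : (0 : ℝ) < N := by exact_mod_cast hN
  have hbias := abs_integral_prodKernel_mul_sub_le hκ (hh.pos N) v hgc (C := max C 0)
    (fun z => by rw [abs_of_nonneg (hg0 z)]; exact hgC z) hgD (by positivity)
  rw [← hD, ← hgT v hv] at hbias
  have hsplit : 1 / (N : ℝ) * (∑ i ∈ Finset.range N,
        cellKernel κ (h N) (fun w => L (wc w)) A v (W i ω)) - f v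
      = 1 / (N : ℝ) * (∑ i ∈ Finset.range N, (cellKernel κ (h N) (fun w => L (wc w)) A v (W i ω)
            - ∫ ω, cellKernel κ (h N) (fun w => L (wc w)) A v (W i ω) ∂μ))
        + ((∫ x, prodKernel κ (h N) v x * g x) - f v) := by
    rw [Finset.sum_sub_distrib]
    simp only [hmean, Finset.sum_const, Finset.card_range, nsmul_eq_mul]
    field_simp
    ring
  rw [hsplit] at hlt
  have hle := hlt.trans_le (abs_add_le _ _)
  have hε : 0 ≤ (Real.log N / ((N : ℝ) * h N ^ Q)) ^ (1 / 2 : ℝ) := by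
    have := hh.pos N
    exact Real.rpow_nonneg (div_nonneg (Real.log_natCast_nonneg N) (by positivity)) _
  have h2 : 0 ≤ A₁ * h N ^ 2 := by positivity
  have h3 : 0 ≤ D * (Real.log N / ((N : ℝ) * h N ^ Q)) ^ (1 / 2 : ℝ) := by positivity
  nlinarith

lemma kernelEstimator_eq_cellKernel {E F : Type*} {m : ℕ} (κ : ℝ → ℝ) (h : ℝ) (N : ℕ)
    {xc : ℕ → Fin m → ℝ} {xd : ℕ → F} {w : ℕ → E} {x : E → Fin m → ℝ} {A : Set E} {wd : F}
    (hx : ∀ i, xc i = x (w i)) (hA : ∀ i, xd i = wd ↔ w i ∈ A) (v : Fin m → ℝ) :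
    kernelEstimator κ h N xc xd v wd
      = 1 / (N : ℝ) * ∑ i ∈ Finset.range N, cellKernel κ h x A v (w i) := by
  classical
  unfold kernelEstimator
  congr 1
  refine Finset.sum_congr rfl fun i _ => ?_
  rw [hx]
  by_cases h : w i ∈ A
  · rw [if_pos ((hA i).2 h), cellKernel, Set.indicator_of_mem h, mul_one, prodKernel]
  · rw [if_neg fun h' => h ((hA i).1 h'), cellKernel, Set.indicator_of_notMem h, mul_zero]

/-- The projection `(y, zᶜ) ↦ zᶜ` as a continuous linear map. -/
noncomputable def tailCLM (p : ℕ) : (Fin (p + 1) → ℝ) →L[ℝ] (Fin p → ℝ) :=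
  ContinuousLinearMap.pi fun j => ContinuousLinearMap.proj j.succ

/-- The section `zᶜ ↦ (0, zᶜ)` of `tailCLM`. -/
noncomputable def consZeroCLM (p : ℕ) : (Fin p → ℝ) →L[ℝ] (Fin (p + 1) → ℝ) :=
  ContinuousLinearMap.pi (Fin.cons 0 fun j => ContinuousLinearMap.proj j)

lemma tailCLM_consZeroCLM {p : ℕ} (z : Fin p → ℝ) : tailCLM p (consZeroCLM p z) = z := by
  funext j
  simp [tailCLM, consZeroCLM]

lemma norm_consZeroCLM_le {p : ℕ} (z : Fin p → ℝ) : ‖consZeroCLM p z‖ ≤ ‖z‖ := by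
  refine (pi_norm_le_iff_of_nonneg (norm_nonneg z)).2 fun j => ?_
  refine Fin.cases ?_ (fun j => ?_) j
  · simp [consZeroCLM]
  · simpa [consZeroCLM] using norm_le_pi_norm z j

theorem theorem4 {Ω P : Type*} [MeasurableSpace Ω] (μ : Measure Ω) [IsProbabilityMeasure μ]
    {p r : ℕ} (X : NetworkSample Ω P p r)
    (hWc : ∀ i, Measurable (X.Wc i)) (hWd : ∀ i, Measurable (X.Wd i))
    (γ₀ : NuisanceParam p r) (hγ₀ : IsTrueNuisance μ X γ₀)
    (κ : ℝ → ℝ) (h : ℕ → ℝ) (Δ : ℕ → ℕ → Finset ℕ)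
    (hsupp : SupportRegular μ X) (hreg : NuisanceRegular μ X γ₀)
    (hκ : KernelRegular κ) (hh : BandwidthRegular (p + 1) h)
    (hΔ : NeighbourhoodsRegular (p + 1) h Δ)
    (M : ℕ) (q : ℕ → ℕ) (I : ℕ → ℕ → Finset ℕ)
    (hpart : ∀ N, 1 ≤ N → IsGreedyPartition N (Δ N) M (q N) (I N))
    (hα : Summable fun N : ℕ => mixingPsi (p + 1) (h (N + 2)) (N + 2)
      (∑ k ∈ Finset.range (q (N + 2)), blockDependence μ X.W (Δ (N + 2)) (I (N + 2)) k)) :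
    IsBigOInProb μ
      (fun N ω => supNormOn (lawSupport μ X.Wc ×ˢ lawSupport μ X.Wd)
        (gammaHat X κ (h N) N ω - γ₀.eval))
      (fun N => (Real.log N / ((N : ℝ) * h N ^ (p + 1))) ^ (1 / 2 : ℝ) + h N ^ 2) := by
  classical
  have hW : ∀ i, Measurable (X.W i) := fun i => (hWc i).prodMk (hWd i)
  have hα0 : Tendsto (fun N : ℕ => mixingPsi (p + 1) (h N) N
      (∑ k ∈ Finset.range (q N), blockDependence μ X.W (Δ N) (I N) k)) atTop (nhds 0) :=
    (tendsto_add_atTop_iff_nat 2).1 hα.tendsto_atTop_zero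
  obtain ⟨U, hU, hTU, C, hC⟩ := hreg
  set T := lawSupport μ X.Wc with hT
  have hTc : IsCompact T := hsupp.isCompact
  have hWT : ∀ i, ∀ᵐ ω ∂μ, (X.W i ω).1 ∈ T := ae_mem_lawSupport μ hWc
  set a : ℕ → ℝ := fun N =>
    (Real.log N / ((N : ℝ) * h N ^ (p + 1))) ^ (1 / 2 : ℝ) + h N ^ 2 with ha
  have hcomp : ∀ wd ∈ lawSupport μ X.Wd, ∀ k : Fin 5, ∃ A₀ : ℝ, 0 < A₀ ∧
      Tendsto (fun N : ℕ => μ {ω | ∃ wc ∈ T, A₀ * a N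
        < |gammaHat X κ (h N) N ω (wc, wd) k - γ₀.eval (wc, wd) k|}) atTop (nhds 0) := by
    -- one vector of observables: `L` selects its continuous part, `xd` its discrete part
    have hcell : ∀ {m : ℕ} (L : (Fin (p + 1) → ℝ) →L[ℝ] (Fin m → ℝ))
        (s : (Fin m → ℝ) →L[ℝ] (Fin (p + 1) → ℝ)), (∀ z, L (s z) = z) → (∀ z, ‖s z‖ ≤ ‖z‖) →
        m ≤ p + 1 → ∀ {F : Type} [MeasurableSpace F] [MeasurableSingletonClass F]
        (xd : DiscObs r → F), Measurable xd → ∀ (f : (Fin m → ℝ) → F → ℝ),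
        IsMixedDensity μ (fun i ω => L (X.Wc i ω)) (fun i ω => xd (X.Wd i ω)) f →
        ∀ wd ∈ lawSupport μ X.Wd, ∀ k : Fin 5,
        (∀ wc, γ₀.eval (wc, wd) k = f (L wc) (xd wd)) →
        (∀ N ω wc, gammaHat X κ (h N) N ω (wc, wd) k
          = kernelEstimator κ (h N) N (fun i => L (X.Wc i ω)) (fun i => xd (X.Wd i ω)) (L wc)
            (xd wd)) →
        ∃ A₀ : ℝ, 0 < A₀ ∧ Tendsto (fun N : ℕ => μ {ω | ∃ wc ∈ T, A₀ * a N
          < |gammaHat X κ (h N) N ω (wc, wd) k - γ₀.eval (wc, wd) k|}) atTop (nhds 0) := by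
      intro m L s hLs hs hm F _ _ xd hxd f hf wd hwd k hγ hγhat
      have hreg := hC wd hwd k
      simp only [hγ] at hreg
      have hA : MeasurableSet {w : ContObs p × DiscObs r | xd w.2 = xd wd} :=
        (hxd.comp measurable_snd) (measurableSet_singleton (xd wd))
      obtain ⟨A₀, hA₀, hlim⟩ := exists_tendsto_measure_cell hW hm (by omega) hκ hh hΔ hpart hα0 L s
        hLs hs hTc hU hTU measurable_fst hWT hA (fun z => hf.nonneg z (xd wd))
        (hf.measurable (xd wd)) (fun i => hf.density i (xd wd)) hreg.1 hreg.2
      refine ⟨A₀, hA₀, tendsto_of_tendsto_of_tendsto_of_le_of_le tendsto_const_nhds hlim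
        (fun _ => zero_le) fun N => measure_mono ?_⟩
      rintro ω ⟨wc, hwc, hlt⟩
      refine ⟨L wc, ⟨wc, hwc, rfl⟩, ?_⟩
      rw [hγ, hγhat, kernelEstimator_eq_cellKernel κ (h N) N (xc := fun i => L (X.Wc i ω))
        (xd := fun i => xd (X.Wd i ω)) (w := fun i => X.W i ω)
        (x := fun w => L w.1) (A := {w | xd w.2 = xd wd}) (fun _ => rfl) (fun _ => Iff.rfl)] at hlt
      exact hlt
    intro wd hwd k
    have hid := @hcell (p + 1) (ContinuousLinearMap.id ℝ (Fin (p + 1) → ℝ))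
      (ContinuousLinearMap.id ℝ (Fin (p + 1) → ℝ)) (fun _ => rfl) (fun _ => le_rfl) le_rfl
    have htail := @hcell p (tailCLM p) (consZeroCLM p) tailCLM_consZeroCLM norm_consZeroCLM_le
      (Nat.le_succ p)
    fin_cases k
    · exact hid (fun d => (d.2.2.2.2.2, d.2.2.2.1, d.2.1)) (by fun_prop) γ₀.fNNYZ hγ₀.fNNYZ wd hwd 0
        (fun _ => rfl) fun _ _ _ => rfl
    · exact htail (fun d => (d.2.2.2.2.2, d.2.2.2.1, d.2.1)) (by fun_prop) γ₀.fNNZ hγ₀.fNNZ wd hwd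
        1 (fun _ => rfl) fun _ _ _ => rfl
    · exact htail (fun d => (d.2.2.1, d.2.2.2.1, d.2.1)) (by fun_prop) γ₀.fSNZ hγ₀.fSNZ wd hwd
        2 (fun _ => rfl) fun _ _ _ => rfl
    · exact htail (fun d => (d.2.2.2.1, d.2.1)) (by fun_prop) γ₀.fNZ hγ₀.fNZ wd hwd
        3 (fun _ => rfl) fun _ _ _ => rfl
    · exact htail (fun d => d.2.1) (by fun_prop) γ₀.fZ hγ₀.fZ wd hwd
        4 (fun _ => rfl) fun _ _ _ => rfl
  have hcomp' : ∀ wd : DiscObs r, ∀ k : Fin 5, ∃ A₀ : ℝ, 0 < A₀ ∧ (wd ∈ lawSupport μ X.Wd →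
      Tendsto (fun N : ℕ => μ {ω | ∃ wc ∈ T, A₀ * a N
        < |gammaHat X κ (h N) N ω (wc, wd) k - γ₀.eval (wc, wd) k|}) atTop (nhds 0)) := by
    intro wd k
    by_cases hwd : wd ∈ lawSupport μ X.Wd
    · obtain ⟨A₀, h1, h2⟩ := hcomp wd hwd k
      exact ⟨A₀, h1, fun _ => h2⟩
    · exact ⟨1, one_pos, fun h => absurd h hwd⟩
  choose A₀ hA₀ hlim using hcomp'
  set S : Finset (DiscObs r) := hsupp.finite.toFinset with hS
  have hmemS : ∀ {wd}, wd ∈ S ↔ wd ∈ lawSupport μ X.Wd := hsupp.finite.mem_toFinset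
  set ev : DiscObs r → Fin 5 → ℕ → Set Ω := fun wd k N => {ω | ∃ wc ∈ T, A₀ wd k * a N
        < |gammaHat X κ (h N) N ω (wc, wd) k - γ₀.eval (wc, wd) k|} with hev
  have hsum : Tendsto (fun N => ∑ wd ∈ S, ∑ k, μ (ev wd k N)) atTop (nhds 0) := by
    have : Tendsto (fun N => ∑ wd ∈ S, ∑ k, μ (ev wd k N)) atTop
        (nhds (∑ wd ∈ S, ∑ _k : Fin 5, 0)) :=
      tendsto_finsetSum _ fun wd hwd => tendsto_finsetSum _ fun k _ => hlim wd k (hmemS.1 hwd)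
    simpa using this
  intro ε hε
  set A := ∑ wd ∈ S, ∑ k, A₀ wd k with hAdef
  have hAle : ∀ wd ∈ S, ∀ k, A₀ wd k ≤ A := by
    intro wd hwd k
    calc A₀ wd k ≤ ∑ k, A₀ wd k :=
          Finset.single_le_sum (fun k _ => (hA₀ wd k).le) (Finset.mem_univ k)
      _ ≤ A := Finset.single_le_sum (f := fun wd => ∑ k, A₀ wd k)
          (fun wd _ => Finset.sum_nonneg fun k _ => (hA₀ wd k).le) hwd
  have hA0 : 0 ≤ A := Finset.sum_nonneg fun wd _ => Finset.sum_nonneg fun k _ => (hA₀ wd k).le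
  refine ⟨A + 1, by positivity, ?_⟩
  have hεpos : (0 : ENNReal) < ENNReal.ofReal ε := ENNReal.ofReal_pos.2 hε
  filter_upwards [hsum.eventually_le_const hεpos] with N hN
  refine le_trans ?_ hN
  have ha0 : 0 ≤ a N := by
    have := hh.pos N
    exact add_nonneg (Real.rpow_nonneg (div_nonneg (Real.log_natCast_nonneg N) (by positivity)) _)
      (sq_nonneg _)
  have hsub : {ω | ENNReal.ofReal ((A + 1) * a N)
      < supNormOn (T ×ˢ lawSupport μ X.Wd) (gammaHat X κ (h N) N ω - γ₀.eval)}
      ⊆ ⋃ wd ∈ S, ⋃ k ∈ (Finset.univ : Finset (Fin 5)), ev wd k N := by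
    intro ω hω
    have hω' : ENNReal.ofReal ((A + 1) * a N) < ⨆ w ∈ T ×ˢ lawSupport μ X.Wd,
        ‖(gammaHat X κ (h N) N ω - γ₀.eval) w‖ₑ := hω
    obtain ⟨⟨wc, wd⟩, hw⟩ := lt_iSup_iff.1 hω'
    obtain ⟨⟨hwc, hwd⟩, hlt⟩ := lt_iSup_iff.1 hw
    rw [← ofReal_norm] at hlt
    have hlt' : (A + 1) * a N < ‖(gammaHat X κ (h N) N ω - γ₀.eval) (wc, wd)‖ := by
      by_contra hcon
      exact absurd hlt (not_lt.2 (ENNReal.ofReal_le_ofReal (not_lt.1 hcon)))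
    obtain ⟨k, hk⟩ : ∃ k, (A + 1) * a N
        < |gammaHat X κ (h N) N ω (wc, wd) k - γ₀.eval (wc, wd) k| := by
      by_contra! hcon
      exact absurd hlt' (not_lt.2 ((pi_norm_le_iff_of_nonneg (by positivity)).2 hcon))
    have hwdS := hmemS.2 hwd
    simp only [Set.mem_iUnion]
    refine ⟨wd, hwdS, k, Finset.mem_univ k, wc, hwc, lt_of_le_of_lt ?_ hk⟩
    gcongr
    linarith [hAle wd hwdS k]
  calc _ ≤ μ (⋃ wd ∈ S, ⋃ k ∈ (Finset.univ : Finset (Fin 5)), ev wd k N) := measure_mono hsub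
    _ ≤ ∑ wd ∈ S, μ (⋃ k ∈ (Finset.univ : Finset (Fin 5)), ev wd k N) :=
        measure_biUnion_finset_le _ _
    _ ≤ ∑ wd ∈ S, ∑ k, μ (ev wd k N) :=
        Finset.sum_le_sum fun wd _ => measure_biUnion_finset_le _ _
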